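/- Let $A\in\mathbb{R}^{n\times n}$, $C\in\mathbb{R}^{m\times n}$, $E\in\mathbb{R}^{n\times q}$, $F\in\mathbb{R}^{m\times q}$, $G\in\mathbb{R}^{l\times n}$, $J\in\mathbb{R}^{l\times q}$ and $L\in\mathbb{R}^{n\times m}$, and consider the estimation error dynamics of the Luenberger observer with gain $L$, $$\dot e(t)=(A-LC)\,e(t)+(E-LF)\,w(t),\qquad z(t)=G\,e(t)+J\,w(t),\qquad t\ge 0,$$ with locally square-integrable inputs $w:[0,\infty)\to\mathbb{R}^q$ and solutions understood in the integral (Carathéodory) sense. Let $Q\in\mathbb{R}^{l\times l}$, $S\in\mathbb{R}^{l\times q}$, $R\in\mathbb{R}^{q\times q}$ with $-Q$ symmetric positive definite and $R=R^\top$. The system is called $(Q,S,R)$-dissipative from $w$ to $z$ if there is a continuous positive definite function $V:\mathbb{R}^n\to\mathbb{R}_{\ge0}$ (that is, $V(0)=0$ and $V(x)>0$ for $x\ne0$) such that, for all inputs $w$, all corresponding trajectories $e$ and all $t_1\ge t_0\ge 0$, $$V(e(t_1))-V(e(t_0))\le\int_{t_0}^{t_1}\begin{bmatrix}z(t)\\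 w(t)\end{bmatrix}^\top\begin{bmatrix}Q&S\\ S^\top&R\end{bmatrix}\begin{bmatrix}z(t)\\ w(t)\end{bmatrix}dt .$$ Then the error dynamics are $(Q,S,R)$-dissipative from $w$ to $z$ if and only if there exist a symmetric positive definite $P\in\mathbb{R}^{n\times n}$ and a matrix $K\in\mathbb{R}^{n\times m}$ such that $$\begin{bmatrix}-\mathcal{H}_s(PA-KC) & -PE+KF+G^\top S & G^\top\\ \star & \mathcal{H}_s(J^\top S)+R & J^\top\\ \star&\star&-Q^{-1}\end{bmatrix}\ge 0\qquad\text{and}\qquad L=P^{-1}K,$$ where $\mathcal{H}_s(M)=M+M^\top$, the symbol $\star$ denotes the blocks determined by symmetry, and $\ge 0$ means symmetric positive semidefinite. -/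

import Mathlib

open MeasureTheory

noncomputable section

/-- A continuous-time linear time-invariant system `ẋ = A x + B u`, `y = C x + D u`
with `n` states, `p` inputs and `m` outputs. -/
structure CTLTISystem (n p m : ℕ) where
  A : Matrix (Fin n) (Fin n) ℝ
  B : Matrix (Fin n) (Fin p) ℝ
  C : Matrix (Fin m) (Fin n) ℝ
  D : Matrix (Fin m) (Fin p) ℝ

namespace CTLTISystem

variable {n p m : ℕ}

/-- The output `y(t) = C x(t) + D u(t)`. -/
def output (sys : CTLTISystem n p m) (x : ℝ → Fin n → ℝ) (u : ℝ → Fin p → ℝ) (t : ℝ) :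
    Fin m → ℝ :=
  sys.C.mulVec (x t) + sys.D.mulVec (u t)

/-- `x` is a state trajectory on `[0, ∞)` for the input `u`. Inputs are locally
square-integrable on `[0, ∞)` (the extended space `L₂ₑ`), and `ẋ = A x + B u` is understood in the
usual (Carathéodory) sense, as an integral equation. -/
structure IsTrajectory (sys : CTLTISystem n p m) (x : ℝ → Fin n → ℝ) (u : ℝ → Fin p → ℝ) :
    Prop where
  input_memLp : ∀ T : ℝ, MemLp u 2 (volume.restrict (Set.Icc 0 T))
  state_continuousOn : ContinuousOn x (Set.Ici 0)
  state_eq : ∀ t : ℝ, 0 ≤ t →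
    x t = x 0 + ∫ s in (0 : ℝ)..t, (sys.A.mulVec (x s) + sys.B.mulVec (u s))

/-- The quadratic supply rate `[y; u]ᵀ [Q S; Sᵀ R] [y; u]`. -/
def supplyRate (Q : Matrix (Fin m) (Fin m) ℝ) (S : Matrix (Fin m) (Fin p) ℝ)
    (R : Matrix (Fin p) (Fin p) ℝ) (y : Fin m → ℝ) (u : Fin p → ℝ) : ℝ :=
  dotProduct (Sum.elim y u)
    ((Matrix.fromBlocks Q S S.transpose R).mulVec (Sum.elim y u))

/-- A (continuous) positive definite function on `ℝⁿ`. -/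
structure IsPosDefFun (V : (Fin n → ℝ) → ℝ) : Prop where
  continuous : Continuous V
  map_zero : V 0 = 0
  pos : ∀ x, x ≠ 0 → 0 < V x

/-- `(Q, S, R)`-dissipativity from the input `u` to the output `y`. The storage function need not
be quadratic. -/
def IsDissipative (sys : CTLTISystem n p m) (Q : Matrix (Fin m) (Fin m) ℝ)
    (S : Matrix (Fin m) (Fin p) ℝ) (R : Matrix (Fin p) (Fin p) ℝ) : Prop :=
  ∃ V : (Fin n → ℝ) → ℝ, IsPosDefFun V ∧
    ∀ (x : ℝ → Fin n → ℝ) (u : ℝ → Fin p → ℝ), sys.IsTrajectory x u →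
      ∀ t₀ t₁ : ℝ, 0 ≤ t₀ → t₀ ≤ t₁ →
        V (x t₁) - V (x t₀) ≤ ∫ t in t₀..t₁, supplyRate Q S R (sys.output x u t) (u t)

end CTLTISystem

/-- The estimation error dynamics `ė = (A - L C) e + (E - L F) w`, `z = G e + J w` of a Luenberger
observer with gain `L`, as a system from the noise `w` to the performance output `z`. -/
def luenbergerErrorSystem {n m q l : ℕ}
    (A : Matrix (Fin n) (Fin n) ℝ) (C : Matrix (Fin m) (Fin n) ℝ)
    (E : Matrix (Fin n) (Fin q) ℝ) (F : Matrix (Fin m) (Fin q) ℝ)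
    (G : Matrix (Fin l) (Fin n) ℝ) (J : Matrix (Fin l) (Fin q) ℝ)
    (L : Matrix (Fin n) (Fin m) ℝ) : CTLTISystem n q l where
  A := A - L * C
  B := E - L * F
  C := G
  D := J

/-- The symmetric part `Hₛ(M) = M + Mᵀ` (without the factor `1/2`). -/
def symPart {n : ℕ} (M : Matrix (Fin n) (Fin n) ℝ) : Matrix (Fin n) (Fin n) ℝ :=
  M + M.transpose

/-- The symmetric `3 × 3` block matrix
```
[ -Hₛ(P A - K C)   -P E + K F + Gᵀ S   Gᵀ   ]
[       ⋆             Hₛ(Jᵀ S) + R     Jᵀ   ]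
[       ⋆                  ⋆          -Q⁻¹  ]
``` -/
def dissipativeObserverLMI {n m q l : ℕ}
    (A : Matrix (Fin n) (Fin n) ℝ) (C : Matrix (Fin m) (Fin n) ℝ)
    (E : Matrix (Fin n) (Fin q) ℝ) (F : Matrix (Fin m) (Fin q) ℝ)
    (G : Matrix (Fin l) (Fin n) ℝ) (J : Matrix (Fin l) (Fin q) ℝ)
    (Q : Matrix (Fin l) (Fin l) ℝ) (S : Matrix (Fin l) (Fin q) ℝ)
    (R : Matrix (Fin q) (Fin q) ℝ)
    (P : Matrix (Fin n) (Fin n) ℝ) (K : Matrix (Fin n) (Fin m) ℝ) :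
    Matrix ((Fin n ⊕ Fin q) ⊕ Fin l) ((Fin n ⊕ Fin q) ⊕ Fin l) ℝ :=
  Matrix.fromBlocks
    (Matrix.fromBlocks
      (-symPart (P * A - K * C)) (-(P * E) + K * F + G.transpose * S)
      (-(P * E) + K * F + G.transpose * S).transpose (symPart (J.transpose * S) + R))
    (Matrix.fromRows G.transpose J.transpose)
    (Matrix.fromCols G J)
    (-Q⁻¹)

end

/-! With `K = P * L`, the Schur complement of the LMI in the block `-Q⁻¹` is the pointwise
dissipation inequality for `xᵀ P x` (`posSemidef_dissipativeObserverLMI_iff`), and integrating that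
inequality makes `xᵀ P x` a storage function. The hard part is to replace an arbitrary continuous
positive definite `V` by a positive definite quadratic form, with no controllability or
observability available (`exists_quadratic_storage`).

`V` enters only through scaling (`exists_scaled_bound`): costs are quadratic, so every path from `x`
to `y` costs at least `c‖y‖² - κ‖x‖²`. Infima of path costs are quadratic forms, by the
parallelogram identity. The two classical choices both fail, however: the available storage may be
degenerate, and the required supply is infinite at unreachable states. The remedy is to make every
state reachable. Since `-Q` is positive definite, zero input gives nonpositive supply. Hence the
free flow is bounded, and the space splits into a stable subspace `ker S` and a subspace `range S`
on which the flow is bounded below. Paths may start anywhere in `range S`, at a cost given by a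
flow-invariant form that dominates `κ‖·‖²` there, and may jump along `ker S` for a penalty. The
lower bound on costs survives because the effect of jumps decays (`le_of_reach_jump`). The required
supply of this enlarged system is a form between `(c/4)‖x‖²` and a multiple of `‖x‖²`.

All this happens in discrete time, with inputs constant on steps of length `h = 1/(n+1)`. The bounds
do not depend on `h`, so a subsequence of the forms converges, and the discrete inequality divided
by `h` tends to the differential one. -/

/-! ### Quadratic functions -/

/-- `q` is homogeneous of degree two and satisfies the parallelogram identity. -/
structure IsQuad {Z : Type*} [AddCommGroup Z] [Module ℝ Z] (q : Z → ℝ) : Prop where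
  smul : ∀ (t : ℝ) (z : Z), q (t • z) = t ^ 2 * q z
  parallelogram : ∀ z z' : Z, q (z + z') + q (z - z') = 2 * q z + 2 * q z'

namespace IsQuad

variable {Z Y : Type*} [AddCommGroup Z] [Module ℝ Z] [AddCommGroup Y] [Module ℝ Y]

theorem add {q r : Z → ℝ} (hq : IsQuad q) (hr : IsQuad r) : IsQuad fun z => q z + r z :=
  ⟨fun t z => by rw [hq.smul, hr.smul]; ring,
    fun z z' => by linarith [hq.parallelogram z z', hr.parallelogram z z']⟩

theorem sub {q r : Z → ℝ} (hq : IsQuad q) (hr : IsQuad r) : IsQuad fun z => q z - r z :=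
  ⟨fun t z => by rw [hq.smul, hr.smul]; ring,
    fun z z' => by linarith [hq.parallelogram z z', hr.parallelogram z z']⟩

theorem const_mul {q : Z → ℝ} (hq : IsQuad q) (c : ℝ) : IsQuad fun z => c * q z :=
  ⟨fun t z => by rw [hq.smul]; ring,
    fun z z' => by linear_combination c * hq.parallelogram z z'⟩

theorem comp {q : Z → ℝ} (hq : IsQuad q) (f : Y →ₗ[ℝ] Z) : IsQuad fun y => q (f y) :=
  ⟨fun t z => by rw [f.map_smul, hq.smul],
    fun z z' => by rw [f.map_add, f.map_sub, hq.parallelogram]⟩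

/-- A nonnegative quadratic function is subadditive up to a factor two. -/
theorem sub_le {q : Z → ℝ} (hq : IsQuad q) (h0 : ∀ z, 0 ≤ q z) (z z' : Z) :
    q (z - z') ≤ 2 * q z + 2 * q z' := by
  linarith [hq.parallelogram z z', h0 (z + z')]

end IsQuad

theorem isQuad_bilin {X : Type*} [NormedAddCommGroup X] [NormedSpace ℝ X]
    (B : X →L[ℝ] X →L[ℝ] ℝ) : IsQuad fun x => B x x :=
  ⟨fun t z => by simp; ring, fun z z' => by simp; ring⟩

theorem isQuad_norm_sq {X : Type*} [NormedAddCommGroup X] [InnerProductSpace ℝ X] :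
    IsQuad fun x : X => ‖x‖ ^ 2 :=
  ⟨fun t z => by rw [norm_smul, mul_pow, Real.norm_eq_abs, sq_abs],
    fun z z' => by have := parallelogram_law_with_norm ℝ z z'; nlinarith⟩

/-! ### Infima that are quadratic forms -/

section JordanVonNeumann

variable {X : Type*} [NormedAddCommGroup X] [NormedSpace ℝ X]

/-- Jordan–von Neumann: a bounded function that is homogeneous of degree two and satisfies one half
of the parallelogram identity is given by a bounded symmetric bilinear form. -/
theorem exists_bilin_of_parallelogram_le {W : X → ℝ} {C : ℝ}
    (hb : ∀ x, |W x| ≤ C * ‖x‖ ^ 2) (hs : ∀ (t : ℝ) x, W (t • x) = t ^ 2 * W x)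
    (hp : ∀ x y, W (x + y) + W (x - y) ≤ 2 * W x + 2 * W y) :
    ∃ B : X →L[ℝ] X →L[ℝ] ℝ, (∀ x y, B x y = B y x) ∧ (∀ x, B x x = W x) ∧
      ∀ x y, |B x y| ≤ 2 * C * (‖x‖ * ‖y‖) := by
  have hpe : ∀ x y, W (x + y) + W (x - y) = 2 * W x + 2 * W y := by
    intro x y
    -- The reverse inequality is the hypothesis applied to `x + y` and `x - y`.
    refine le_antisymm (hp x y) ?_
    have h := hp (x + y) (x - y)
    have e1 : x + y + (x - y) = (2 : ℝ) • x := by rw [two_smul]; abel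
    have e2 : x + y - (x - y) = (2 : ℝ) • y := by rw [two_smul]; abel
    rw [e1, e2, hs, hs] at h
    linarith
  have hneg : ∀ x, W (-x) = W x := by
    intro x
    have := hs (-1) x
    simpa using this
  set D : X → X → ℝ := fun x y => (W (x + y) - W (x - y)) / 4 with hD
  have hmid : ∀ x z y, D (x + z) y + D (x - z) y = 2 * D x y := by
    intro x z y
    have h1 := hpe (x + y) z
    have h2 := hpe (x - y) z
    have e1 : x + y + z = x + z + y := by abel
    have e2 : x + y - z = x - z + y := by abel
    have e3 : x - y + z = x + z - y := by abel
    have e4 : x - y - z = x - z - y := by abel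
    rw [e1, e2] at h1
    rw [e3, e4] at h2
    simp only [hD]
    linarith
  have hzero : ∀ y, D 0 y = 0 := by
    intro y
    simp [hD, hneg]
  have hadd : ∀ x z y, D (x + z) y = D x y + D z y := by
    intro x z y
    have h1 := hmid ((1 / 2 : ℝ) • (x + z)) ((1 / 2 : ℝ) • (x - z)) y
    have h2 := hmid ((1 / 2 : ℝ) • (x + z)) ((1 / 2 : ℝ) • (x + z)) y
    have e1 : (1 / 2 : ℝ) • (x + z) + (1 / 2 : ℝ) • (x - z) = x := by module
    have e2 : (1 / 2 : ℝ) • (x + z) - (1 / 2 : ℝ) • (x - z) = z := by module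
    have e3 : (1 / 2 : ℝ) • (x + z) + (1 / 2 : ℝ) • (x + z) = x + z := by module
    rw [e1, e2] at h1
    rw [e3, sub_self, hzero] at h2
    linarith
  have hsymm : ∀ x y, D x y = D y x := by
    intro x y
    have := hneg (x - y)
    rw [neg_sub] at this
    simp only [hD]
    rw [add_comm y x, this]
  have hbound1 : ∀ x y, |D x y| ≤ C / 2 * (‖x‖ + ‖y‖) ^ 2 := by
    intro x y
    have hC : 0 ≤ C ∨ ‖x‖ + ‖y‖ = 0 := by
      rcases eq_or_ne x 0 with rfl | hx
      · rcases eq_or_ne y 0 with rfl | hy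
        · right; simp
        · left
          have := (abs_nonneg _).trans (hb y)
          have hy' : 0 < ‖y‖ ^ 2 := by positivity
          exact nonneg_of_mul_nonneg_left this hy'
      · left
        have := (abs_nonneg _).trans (hb x)
        have hx' : 0 < ‖x‖ ^ 2 := by positivity
        exact nonneg_of_mul_nonneg_left this hx'
    rcases hC with hC | h0
    · have h1 := abs_le.1 (hb (x + y))
      have h2 := abs_le.1 (hb (x - y))
      have h3 : C * ‖x + y‖ ^ 2 ≤ C * (‖x‖ + ‖y‖) ^ 2 := by gcongr; exact norm_add_le x y
      have h4 : C * ‖x - y‖ ^ 2 ≤ C * (‖x‖ + ‖y‖) ^ 2 := by gcongr; exact norm_sub_le x y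
      simp only [hD]
      rw [abs_le]
      constructor <;> linarith [h1.1, h1.2, h2.1, h2.2]
    · have hx : x = 0 := norm_eq_zero.1 (by linarith [norm_nonneg x, norm_nonneg y])
      have hy : y = 0 := norm_eq_zero.1 (by linarith [norm_nonneg x, norm_nonneg y])
      subst hx; subst hy
      simp [hD]
  have hsmul : ∀ (t : ℝ) x y, D (t • x) y = t * D x y := by
    intro t x y
    let f : X →+ ℝ := AddMonoidHom.mk' (fun x => D x y) fun a b => hadd a b y
    -- An additive map that is bounded near zero is continuous, hence real-linear.
    have hf : Continuous f := by
      refine f.continuous_of_isBounded_nhds_zero (Metric.ball_mem_nhds 0 one_pos) ?_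
      refine (Metric.isBounded_closedBall (x := (0 : ℝ)) (r := |C| / 2 * (1 + ‖y‖) ^ 2)).subset ?_
      rintro _ ⟨x, hx, rfl⟩
      rw [mem_ball_zero_iff] at hx
      rw [mem_closedBall_zero_iff, Real.norm_eq_abs]
      refine (hbound1 x y).trans ?_
      gcongr
      exact le_abs_self C
    have := map_real_smul f hf t x
    simpa [f] using this
  have hunit : ∀ x y, |D x y| ≤ 2 * C * (‖x‖ * ‖y‖) := by
    intro x y
    rcases eq_or_ne x 0 with rfl | hx
    · simp [hzero]
    rcases eq_or_ne y 0 with rfl | hy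
    · rw [hsymm]; simp [hzero]
    have hx' : 0 < ‖x‖ := norm_pos_iff.2 hx
    have hy' : 0 < ‖y‖ := norm_pos_iff.2 hy
    have h1 : D x y = ‖x‖ * ‖y‖ * D (‖x‖⁻¹ • x) (‖y‖⁻¹ • y) := by
      rw [hsmul, hsymm x (‖y‖⁻¹ • y), hsmul, hsymm y x]
      field_simp
    have h2 := hbound1 (‖x‖⁻¹ • x) (‖y‖⁻¹ • y)
    rw [norm_smul, norm_smul, norm_inv, norm_inv, norm_norm, norm_norm,
      inv_mul_cancel₀ hx'.ne', inv_mul_cancel₀ hy'.ne'] at h2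
    rw [h1, abs_mul, abs_of_pos (by positivity)]
    have : ‖x‖ * ‖y‖ * |D (‖x‖⁻¹ • x) (‖y‖⁻¹ • y)| ≤ ‖x‖ * ‖y‖ * (C / 2 * (1 + 1) ^ 2) := by
      gcongr
    linarith
  let B₀ : X →ₗ[ℝ] X →ₗ[ℝ] ℝ := LinearMap.mk₂ ℝ D hadd hsmul
    (fun x y z => by rw [hsymm, hadd, hsymm y, hsymm z])
    (fun t x y => by rw [hsymm, hsmul, hsymm y]; rfl)
  refine ⟨B₀.mkContinuous₂ (2 * C) fun x y => ?_, fun x y => hsymm x y, fun x => ?_,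
    fun x y => hunit x y⟩
  · rw [Real.norm_eq_abs, mul_assoc]
    exact hunit x y
  · change D x x = W x
    have h0 : W 0 = 0 := by simpa using hs 0 0
    have h2 := hs 2 x
    simp only [hD]
    rw [← two_smul ℝ x, sub_self, h0, h2]
    ring

/-- The lower envelope of a set of values that is closed under scaling and under the parallelogram
inequality is a bounded symmetric quadratic form. -/
theorem exists_bilin_isGLB {R : X → ℝ → Prop} {C : ℝ}
    (hlow : ∀ x a, R x a → -(C * ‖x‖ ^ 2) ≤ a) (hup : ∀ x, ∃ a, R x a ∧ a ≤ C * ‖x‖ ^ 2)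
    (hs : ∀ (t : ℝ) x a, R x a → R (t • x) (t ^ 2 * a))
    (hp : ∀ x y a b, R x a → R y b →
      ∃ c d, R (x + y) c ∧ R (x - y) d ∧ c + d ≤ 2 * a + 2 * b) :
    ∃ B : X →L[ℝ] X →L[ℝ] ℝ, (∀ x y, B x y = B y x) ∧
      (∀ x y, |B x y| ≤ 2 * C * (‖x‖ * ‖y‖)) ∧ ∀ x, IsGLB {a | R x a} (B x x) := by
  have hne : ∀ x, {a | R x a}.Nonempty := fun x => (hup x).imp fun a h => h.1
  have hbdd : ∀ x, BddBelow {a | R x a} := fun x => ⟨_, fun a ha => hlow x a ha⟩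
  set W : X → ℝ := fun x => sInf {a | R x a} with hW
  have hglb : ∀ x, IsGLB {a | R x a} (W x) := fun x => isGLB_csInf (hne x) (hbdd x)
  have hnear : ∀ x (ε : ℝ), 0 < ε → ∃ a, R x a ∧ a < W x + ε := fun x ε hε => by
    obtain ⟨a, ha, h⟩ := exists_lt_of_csInf_lt (hne x) (show W x < W x + ε by linarith)
    exact ⟨a, ha, h⟩
  have hle : ∀ (t : ℝ) x, W (t • x) ≤ t ^ 2 * W x := by
    intro t x
    refine le_of_forall_pos_le_add fun ε hε => ?_
    obtain ⟨a, ha, h⟩ := hnear x (ε / (t ^ 2 + 1)) (by positivity)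
    have h1 := (hglb (t • x)).1 (hs t x a ha)
    have h2 : t ^ 2 * a ≤ t ^ 2 * (W x + ε / (t ^ 2 + 1)) := by gcongr
    have h3 : t ^ 2 * (ε / (t ^ 2 + 1)) ≤ ε := by
      rw [← mul_div_assoc, div_le_iff₀ (by positivity)]
      nlinarith
    linarith
  have h0 : W 0 = 0 := by
    refine le_antisymm ?_ ?_
    · simpa using hle 0 0
    · refine le_csInf (hne 0) fun a ha => ?_
      simpa using hlow 0 a ha
  obtain ⟨B, hB1, hB2, hB3⟩ := exists_bilin_of_parallelogram_le (W := W) (C := C)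
    (fun x => by
      rw [abs_le]
      refine ⟨le_csInf (hne x) fun a ha => hlow x a ha, ?_⟩
      obtain ⟨a, ha, h⟩ := hup x
      exact ((hglb x).1 ha).trans h)
    (fun t x => by
      rcases eq_or_ne t 0 with rfl | ht
      · simp [h0]
      refine le_antisymm (hle t x) ?_
      have h := hle t⁻¹ (t • x)
      rw [inv_smul_smul₀ ht] at h
      have ht2 : 0 < t ^ 2 := by positivity
      calc t ^ 2 * W x ≤ t ^ 2 * (t⁻¹ ^ 2 * W (t • x)) := by gcongr
        _ = W (t • x) := by field_simp)
    (fun x y => by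
      refine le_of_forall_pos_le_add fun ε hε => ?_
      obtain ⟨a, ha, h1⟩ := hnear x (ε / 4) (by positivity)
      obtain ⟨b, hb, h2⟩ := hnear y (ε / 4) (by positivity)
      obtain ⟨c, d, hc, hd, h3⟩ := hp x y a b ha hb
      linarith [(hglb _).1 hc, (hglb _).1 hd])
  exact ⟨B, hB1, hB3, fun x => by rw [hB2]; exact hglb x⟩

end JordanVonNeumann

/-! ### Paths of discrete-time systems and their costs -/

/-- `Reach φ q N x y a`: the discrete-time system `x⁺ = φ (x, u)` can be steered from `x` to `y` in
`N` steps at the total cost `a`, where a single step costs `q (x, u)`. -/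
inductive Reach {X U : Type*} (φ : X × U → X) (q : X × U → ℝ) : ℕ → X → X → ℝ → Prop
  | refl (x : X) : Reach φ q 0 x x 0
  | step {N : ℕ} {x y : X} {a : ℝ} (u : U) :
      Reach φ q N x y a → Reach φ q (N + 1) x (φ (y, u)) (a + q (y, u))

namespace Reach

variable {X U : Type*}

theorem cast {φ : X × U → X} {q : X × U → ℝ} {N : ℕ} {x y y' : X} {a a' : ℝ}
    (h : Reach φ q N x y a) (hy : y = y') (ha : a = a') : Reach φ q N x y' a' := hy ▸ ha ▸ h

theorem prepend {φ : X × U → X} {q : X × U → ℝ} {N : ℕ} {x y : X} {a : ℝ} (x' : X) (u : U)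
    (hx : φ (x', u) = x) (h : Reach φ q N x y a) : Reach φ q (N + 1) x' y (q (x', u) + a) := by
  induction h with
  | refl x => exact ((refl x').step u).cast hx (by ring)
  | step v _ ih => exact ((ih hx).step v).cast rfl (by ring)

theorem sub_le {φ : X × U → X} {q : X × U → ℝ} {V : X → ℝ}
    (hV : ∀ z, V (φ z) - V z.1 ≤ q z) {N : ℕ} {x y : X} {a : ℝ} (h : Reach φ q N x y a) :
    V y - V x ≤ a := by
  induction h with
  | refl x => simp
  | @step N x y a u _ ih => linarith [hV (y, u)]

variable [AddCommGroup X] [Module ℝ X] [AddCommGroup U] [Module ℝ U]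

theorem smul {φ : X × U →ₗ[ℝ] X} {q : X × U → ℝ} (hq : IsQuad q) (t : ℝ) {N : ℕ} {x y : X} {a : ℝ}
    (h : Reach φ q N x y a) : Reach φ q N (t • x) (t • y) (t ^ 2 * a) := by
  induction h with
  | refl x => exact (refl _).cast rfl (by simp)
  | @step N x y a u _ ih =>
    refine (ih.step (t • u)).cast ?_ ?_
    · rw [← φ.map_smul, Prod.smul_mk]
    · rw [← Prod.smul_mk, hq.smul]; ring

/-- Inputs and states are added and subtracted step by step, which requires paths of equal length.
This is the source of the quadraticity of optimal costs. -/
theorem parallelogram {φ : X × U →ₗ[ℝ] X} {q : X × U → ℝ} (hq : IsQuad q) {N : ℕ} {x y : X}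
    {a : ℝ} (h : Reach φ q N x y a) {x' y' : X} {a' : ℝ} (h' : Reach φ q N x' y' a') :
    ∃ c d, Reach φ q N (x + x') (y + y') c ∧ Reach φ q N (x - x') (y - y') d ∧
      c + d = 2 * a + 2 * a' := by
  induction h generalizing x' y' a' with
  | refl x =>
    cases h'
    exact ⟨0, 0, refl _, refl _, by simp⟩
  | @step N x y a u _ ih =>
    cases h' with
    | @step _ _ y' a' u' h' =>
      obtain ⟨c, d, hc, hd, hcd⟩ := ih h'
      refine ⟨_, _, (hc.step (u + u')).cast ?_ rfl, (hd.step (u - u')).cast ?_ rfl, ?_⟩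
      · rw [← φ.map_add, Prod.mk_add_mk]
      · rw [← φ.map_sub, Prod.mk_sub_mk]
      · have := hq.parallelogram (y, u) (y', u')
        rw [Prod.mk_add_mk, Prod.mk_sub_mk] at this
        linarith

/-- Steps with zero input never raise the cost; appending them brings two paths to a common length
for `parallelogram`. -/
theorem extend {φ : X × U →ₗ[ℝ] X} {q : X × U → ℝ} (h0 : ∀ x, q (x, 0) ≤ 0) {N : ℕ} {x y : X}
    {a : ℝ} (h : Reach φ q N x y a) (k : ℕ) : ∃ y' a', Reach φ q (N + k) x y' a' ∧ a' ≤ a := by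
  induction k with
  | zero => exact ⟨y, a, h, le_rfl⟩
  | succ k ih =>
    obtain ⟨y', a', h', ha'⟩ := ih
    exact ⟨_, _, h'.step 0, by linarith [h0 y']⟩

end Reach

/-! ### Available storage and required supply -/

section Storage

variable {X U : Type*} [NormedAddCommGroup X] [NormedSpace ℝ X] [AddCommGroup U] [Module ℝ U]

/-- The available storage of a linear system with quadratic supply rate is a quadratic form. -/
theorem exists_available_storage {φ : X × U →ₗ[ℝ] X} {q : X × U → ℝ} (hq : IsQuad q)
    (h0 : ∀ x, q (x, 0) ≤ 0) {κ : ℝ} (hκ : 0 ≤ κ)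
    (hlow : ∀ N x y a, Reach φ q N x y a → -(κ * ‖x‖ ^ 2) ≤ a) :
    ∃ P : X →L[ℝ] X →L[ℝ] ℝ, (∀ x y, |P x y| ≤ 2 * κ * (‖x‖ * ‖y‖)) ∧
      (∀ x y, P x y = P y x) ∧
      (∀ x, 0 ≤ P x x) ∧ (∀ x, P x x ≤ κ * ‖x‖ ^ 2) ∧
      ∀ z, P (φ z) (φ z) - P z.1 z.1 ≤ q z := by
  -- `B` is the infimum of the costs of paths leaving `x`; the available storage is `-B`.
  obtain ⟨B, hBs, hBn, hB⟩ := exists_bilin_isGLB (X := X) (C := κ)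
    (R := fun x a => ∃ N y, Reach φ q N x y a)
    (fun x a ⟨N, y, h⟩ => hlow N x y a h)
    (fun x => ⟨0, ⟨0, x, .refl x⟩, by positivity⟩)
    (fun t x a ⟨N, y, h⟩ => ⟨N, _, h.smul hq t⟩)
    (fun x y a b ⟨N, x', hx⟩ ⟨M, y', hy⟩ => by
      obtain ⟨x'', a', hx, ha⟩ := hx.extend h0 M
      obtain ⟨y'', b', hy, hb⟩ := hy.extend h0 N
      rw [add_comm M N] at hy
      obtain ⟨c, d, hc, hd, h⟩ := hx.parallelogram hq hy
      exact ⟨c, d, ⟨_, _, hc⟩, ⟨_, _, hd⟩, by linarith⟩)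
  refine ⟨-B, fun x y => ?_, fun x y => ?_, fun x => ?_, fun x => ?_, fun z => ?_⟩
  · simpa using hBn x y
  · simpa using hBs x y
  · have := (hB x).1 ⟨0, x, .refl x⟩
    simpa using this
  · have := (hB x).2 (show -(κ * ‖x‖ ^ 2) ∈ _ from fun a ⟨N, y, h⟩ => hlow N x y a h)
    simp only [neg_apply]
    linarith
  · have : B z.1 z.1 - q z ≤ B (φ z) (φ z) := by
      refine (hB (φ z)).2 ?_
      rintro a ⟨N, y, h⟩
      have := (hB z.1).1 ⟨_, y, h.prepend z.1 z.2 rfl⟩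
      simp only [Prod.mk.eta] at this
      linarith
    simp only [neg_apply]
    linarith

/-- The required supply, with an initial cost `H` on an invariant subspace `R₀` of initial states, is
a quadratic storage function. -/
theorem exists_required_supply {φ : X × U →ₗ[ℝ] X} {q : X × U → ℝ} (hq : IsQuad q)
    (h0 : ∀ x, q (x, 0) ≤ 0) (R₀ : Submodule ℝ X)
    (hback : ∀ x ∈ R₀, ∃ x' ∈ R₀, φ (x', 0) = x) {H : X → ℝ} (hH : IsQuad H)
    (hinv : ∀ x, H (φ (x, 0)) = H x) {c C : ℝ} (hc : 0 ≤ c) (hC : 0 ≤ C)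
    (hlow : ∀ N x₀ x a, x₀ ∈ R₀ → Reach φ q N x₀ x a → c * ‖x‖ ^ 2 ≤ H x₀ + a)
    (hup : ∀ x, ∃ N, ∃ x₀ ∈ R₀, ∃ a, Reach φ q N x₀ x a ∧ H x₀ + a ≤ C * ‖x‖ ^ 2) :
    ∃ B : X →L[ℝ] X →L[ℝ] ℝ, (∀ x y, B x y = B y x) ∧
      (∀ x y, |B x y| ≤ 2 * C * (‖x‖ * ‖y‖)) ∧ (∀ x, c * ‖x‖ ^ 2 ≤ B x x) ∧
      ∀ z, B (φ z) (φ z) - B z.1 z.1 ≤ q z := by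
  -- Here the endpoint is prescribed, so paths are padded at their start: the free motion is run
  -- backwards inside `R₀`, which keeps `H` and does not raise the cost.
  have hext : ∀ k N x₀ x a, x₀ ∈ R₀ → Reach φ q N x₀ x a →
      ∃ x₀' ∈ R₀, ∃ a', Reach φ q (N + k) x₀' x a' ∧ H x₀' + a' ≤ H x₀ + a := by
    intro k
    induction k with
    | zero => exact fun N x₀ x a hx h => ⟨x₀, hx, a, h, le_rfl⟩
    | succ k ih =>
      intro N x₀ x a hx h
      obtain ⟨x₁, hx₁, a₁, h₁, hle⟩ := ih N x₀ x a hx h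
      obtain ⟨x₂, hx₂, rfl⟩ := hback x₁ hx₁
      refine ⟨x₂, hx₂, _, h₁.prepend x₂ 0 rfl, ?_⟩
      linarith [h0 x₂, hinv x₂]
  obtain ⟨B, hBs, hBn, hB⟩ := exists_bilin_isGLB (X := X) (C := C)
    (R := fun x b => ∃ N, ∃ x₀ ∈ R₀, ∃ a, Reach φ q N x₀ x a ∧ b = H x₀ + a)
    (fun x b ⟨N, x₀, hx₀, a, h, hb⟩ => by
      have := hlow N x₀ x a hx₀ h
      have h1 : 0 ≤ c * ‖x‖ ^ 2 := by positivity
      have h2 : 0 ≤ C * ‖x‖ ^ 2 := by positivity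
      linarith)
    (fun x => by
      obtain ⟨N, x₀, hx₀, a, h, hle⟩ := hup x
      exact ⟨_, ⟨N, x₀, hx₀, a, h, rfl⟩, hle⟩)
    (fun t x b ⟨N, x₀, hx₀, a, h, hb⟩ =>
      ⟨N, _, R₀.smul_mem t hx₀, _, h.smul hq t, by rw [hH.smul, hb]; ring⟩)
    (fun x y b b' ⟨N, x₀, hx₀, a, h, hb⟩ ⟨N', y₀, hy₀, a', h', hb'⟩ => by
      obtain ⟨x₁, hx₁, a₁, h₁, hle₁⟩ := hext N' N x₀ x a hx₀ h
      obtain ⟨y₁, hy₁, a₂, h₂, hle₂⟩ := hext N N' y₀ y a' hy₀ h'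
      rw [add_comm N' N] at h₂
      obtain ⟨c, d, hc, hd, hcd⟩ := h₁.parallelogram hq h₂
      refine ⟨_, _, ⟨_, _, R₀.add_mem hx₁ hy₁, c, hc, rfl⟩,
        ⟨_, _, R₀.sub_mem hx₁ hy₁, d, hd, rfl⟩, ?_⟩
      linarith [hH.parallelogram x₁ y₁])
  refine ⟨B, hBs, hBn, fun x => (hB x).2 ?_, fun z => ?_⟩
  · rintro b ⟨N, x₀, hx₀, a, h, rfl⟩
    exact hlow N x₀ x a hx₀ h
  · have : B (φ z) (φ z) - q z ≤ B z.1 z.1 := by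
      refine (hB z.1).2 ?_
      rintro b ⟨N, x₀, hx₀, a, h, rfl⟩
      have := (hB (φ z)).1 ⟨_, x₀, hx₀, _, (h.step z.2).cast rfl rfl, rfl⟩
      simp only [Prod.mk.eta] at this
      linarith
    linarith

end Storage

/-! ### Jumps into a stable subspace -/

section Jump

variable {X U : Type*} [NormedAddCommGroup X] [InnerProductSpace ℝ X] [AddCommGroup U] [Module ℝ U]

/-- The system `x⁺ = φ (x, u) + d` with an additional input `d` in the subspace `E`. -/
noncomputable def jumpStep (φ : X × U →ₗ[ℝ] X) (E : Submodule ℝ X) : X × (U × E) →ₗ[ℝ] X :=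
  φ ∘ₗ (LinearMap.fst ℝ X (U × E)).prod (LinearMap.fst ℝ U E ∘ₗ LinearMap.snd ℝ X (U × E)) +
    E.subtype ∘ₗ LinearMap.snd ℝ U E ∘ₗ LinearMap.snd ℝ X (U × E)

@[simp]
theorem jumpStep_apply (φ : X × U →ₗ[ℝ] X) (E : Submodule ℝ X) (x : X) (u : U) (d : E) :
    jumpStep φ E (x, (u, d)) = φ (x, u) + d := by
  simp [jumpStep]

/-- The supply rate of the system with jumps: the cost `q`, the change in the storage `P` due to the
jump, and a penalty on the jump. -/
noncomputable def jumpCost (φ : X × U →ₗ[ℝ] X) (q : X × U → ℝ) (P : X →L[ℝ] X →L[ℝ] ℝ) (E : Submodule ℝ X)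
    (g : ℝ) (z : X × (U × E)) : ℝ :=
  q (z.1, z.2.1) + P (jumpStep φ E z) (jumpStep φ E z) - P (φ (z.1, z.2.1)) (φ (z.1, z.2.1)) +
    g * ‖(z.2.2 : X)‖ ^ 2

theorem isQuad_jumpCost (φ : X × U →ₗ[ℝ] X) {q : X × U → ℝ} (hq : IsQuad q)
    (P : X →L[ℝ] X →L[ℝ] ℝ) (E : Submodule ℝ X) (g : ℝ) : IsQuad (jumpCost φ q P E g) := by
  let f : X × (U × E) →ₗ[ℝ] X × U :=
    (LinearMap.fst ℝ X (U × E)).prod (LinearMap.fst ℝ U E ∘ₗ LinearMap.snd ℝ X (U × E))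
  exact (((hq.comp f).add ((isQuad_bilin P).comp (jumpStep φ E))).sub
    ((isQuad_bilin P).comp (φ ∘ₗ f))).add
      ((isQuad_norm_sq.comp
        (E.subtype ∘ₗ LinearMap.snd ℝ U E ∘ₗ LinearMap.snd ℝ X (U × E))).const_mul g)

theorem jumpCost_zero (φ : X × U →ₗ[ℝ] X) (q : X × U → ℝ) (P : X →L[ℝ] X →L[ℝ] ℝ)
    (E : Submodule ℝ X) (g : ℝ) (x : X) (u : U) : jumpCost φ q P E g (x, (u, 0)) = q (x, u) := by
  simp [jumpCost]

/-- A lower bound on the cost in terms of the endpoints persists if jumps into an exponentially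
stable subspace are allowed. -/
theorem le_of_reach_jump {φ : X × U →ₗ[ℝ] X} {q : X × U → ℝ} (hq : IsQuad q)
    {c κ : ℝ} (hstar : ∀ N x y a, Reach φ q N x y a → c * ‖y‖ ^ 2 - κ * ‖x‖ ^ 2 ≤ a) (hc : 0 ≤ c)
    {P : X →L[ℝ] X →L[ℝ] ℝ} (hP0 : ∀ x, 0 ≤ P x x) (hPκ : ∀ x, P x x ≤ κ * ‖x‖ ^ 2)
    (hP : ∀ z, P (φ z) (φ z) - P z.1 z.1 ≤ q z)
    {E : Submodule ℝ X} (hE : ∀ y ∈ E, φ (y, 0) ∈ E)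
    {Λ : X → ℝ} {α β b K L g : ℝ} (hΛ0 : Λ 0 = 0) (hΛb : ∀ y ∈ E, b * ‖y‖ ^ 2 ≤ Λ y)
    (hΛ : ∀ y ∈ E, ∀ d ∈ E, Λ (φ (y, 0) + d) ≤ Λ y - α * ‖y‖ ^ 2 + β * ‖d‖ ^ 2)
    (hσ : ∀ y, q (y, 0) - P (φ (y, 0)) (φ (y, 0)) + P y y ≤ K * ‖y‖ ^ 2)
    (hL0 : 0 ≤ L) (hLα : 2 * K ≤ L * α) (hLb : 2 * κ + c ≤ L * b) (hg : L * β ≤ 2 * g)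
    {N : ℕ} {x₀ x : X} {a : ℝ} (hr : Reach (jumpStep φ E) (jumpCost φ q P E g) N x₀ x a) :
    c / 4 * ‖x‖ ^ 2 - κ * ‖x₀‖ ^ 2 ≤ a := by
  have hσq : IsQuad fun z : X × U => q z - P (φ z) (φ z) + P z.1 z.1 :=
    (hq.sub ((isQuad_bilin P).comp φ)).add ((isQuad_bilin P).comp (LinearMap.fst ℝ X U))
  -- `y` is the response to the jumps alone, so `x - y` follows a jump-free path with the same
  -- inputs. Let `σ` be the nonnegative form in `hσq`. Then `a - P x x + P x₀ x₀` is the sum of `σ`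
  -- over the steps plus the penalties `g‖d‖²`. In `σ(x - y, w) ≤ 2σ(x, w) + 2σ(y, 0)`, the decay of
  -- `L * Λ` pays for `σ(y, 0)`, and the penalties pay for the growth of `Λ` by jumps.
  have key : ∃ y ∈ E, ∃ a', Reach φ q N x₀ (x - y) a' ∧
      a' - P (x - y) (x - y) + P x₀ x₀ + L * Λ y ≤ 2 * (a - P x x + P x₀ x₀) := by
    clear hLb hstar
    induction hr with
    | refl x => exact ⟨0, E.zero_mem, 0, by simpa using Reach.refl x, by simp [hΛ0]⟩
    | @step N x₀ x a u _ ih =>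
      obtain ⟨w, d⟩ := u
      obtain ⟨y, hy, a', ha', hle⟩ := ih
      refine ⟨φ (y, 0) + d, E.add_mem (hE y hy) d.2, _, (ha'.step w).cast ?_ rfl, ?_⟩
      · rw [jumpStep_apply, show (x - y, w) = (x, w) - (y, 0) by simp, φ.map_sub]
        abel
      have h1 := hσq.sub_le (fun z => by linarith [hP z]) (x, w) (y, 0)
      have e1 : (x, w) - (y, 0) = (x - y, w) := by simp
      rw [e1] at h1
      simp only at h1
      have h2 := hσ y
      have h3 := mul_le_mul_of_nonneg_left (hΛ y hy d d.2) hL0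
      have h4 : 2 * K * ‖y‖ ^ 2 ≤ L * α * ‖y‖ ^ 2 := by gcongr
      have h5 : L * β * ‖(d : X)‖ ^ 2 ≤ 2 * g * ‖(d : X)‖ ^ 2 := by gcongr
      have e2 : jumpStep φ E (x, (w, d)) - (φ (y, 0) + d) = φ (x - y, w) := by
        rw [jumpStep_apply, ← e1, φ.map_sub]
        abel
      rw [e2]
      simp only [jumpCost]
      linarith
  obtain ⟨y, hy, a', ha', hle⟩ := key
  have h1 := hstar _ _ _ _ ha'
  have h2 := (isQuad_bilin P).sub_le hP0 x y
  have h3 := mul_le_mul_of_nonneg_left (hΛb y hy) hL0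
  have h4 : (2 * κ + c) * ‖y‖ ^ 2 ≤ L * b * ‖y‖ ^ 2 := by gcongr
  -- This loses a factor 2, and `key` loses another; hence `c / 4`.
  have h5 := (isQuad_norm_sq (X := X)).sub_le (fun z => by positivity) (x - y) (-y)
  simp only [sub_neg_eq_add, sub_add_cancel, norm_neg] at h5
  have h6 := mul_le_mul_of_nonneg_left h5 hc
  linarith [hPκ y, hPκ x₀]

end Jump

/-! ### Bounded linear flows: splitting and Lyapunov function -/

section Flow

open Filter Topology Set

variable {X : Type*} [NormedAddCommGroup X] [NormedSpace ℝ X] [CompleteSpace X]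

/-- The flow `exp (t A)` of the linear equation `ẋ = A x`. -/
noncomputable def linFlow (A : X →L[ℝ] X) (t : ℝ) : X →L[ℝ] X := NormedSpace.exp (t • A)

variable (A : X →L[ℝ] X)

omit [CompleteSpace X] in
theorem linFlow_zero : linFlow A 0 = 1 := by simp [linFlow, NormedSpace.exp_zero]

theorem linFlow_add (s t : ℝ) : linFlow A (s + t) = linFlow A s * linFlow A t := by
  let _ : NormedAlgebra ℚ (X →L[ℝ] X) := NormedAlgebra.restrictScalars ℚ ℝ _
  rw [linFlow, add_smul]
  exact NormedSpace.exp_add_of_commute (((Commute.refl A).smul_left s).smul_right t)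

theorem linFlow_add_apply (s t : ℝ) (x : X) :
    linFlow A (s + t) x = linFlow A s (linFlow A t x) := by
  rw [linFlow_add]; rfl

theorem linFlow_neg_apply (t : ℝ) (x : X) : linFlow A (-t) (linFlow A t x) = x := by
  rw [← linFlow_add_apply, neg_add_cancel, linFlow_zero]; rfl

theorem linFlow_apply_neg (t : ℝ) (x : X) : linFlow A t (linFlow A (-t) x) = x := by
  rw [← linFlow_add_apply, add_neg_cancel, linFlow_zero]; rfl

theorem hasDerivAt_linFlow (t : ℝ) : HasDerivAt (linFlow A) (A * linFlow A t) t :=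
  hasDerivAt_exp_smul_const' A t

theorem hasDerivAt_linFlow_apply (x : X) (t : ℝ) :
    HasDerivAt (fun t => linFlow A t x) (A (linFlow A t x)) t :=
  (ContinuousLinearMap.apply ℝ X x).hasFDerivAt.comp_hasDerivAt t (hasDerivAt_linFlow A t)

theorem continuous_linFlow : Continuous (linFlow A) :=
  continuous_iff_continuousAt.2 fun t => (hasDerivAt_linFlow A t).continuousAt

theorem continuous_linFlow_apply (x : X) : Continuous fun t => linFlow A t x :=
  (continuous_linFlow A).clm_apply continuous_const

theorem exists_linFlow_bound (τ : ℝ) : ∃ M > 0, ∀ t ∈ Icc (-τ) τ, ‖linFlow A t‖ ≤ M := by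
  obtain ⟨M, hM⟩ := (isCompact_Icc (a := -τ) (b := τ)).exists_bound_of_continuousOn
    (continuous_linFlow A).continuousOn
  exact ⟨max M 1, by positivity, fun t ht => (hM t ht).trans (le_max_left _ _)⟩

theorem norm_linFlow_sub_one_le {M : ℝ} (hM : ∀ t, 0 ≤ t → ‖linFlow A t‖ ≤ M) {h : ℝ}
    (hh : 0 ≤ h) : ‖linFlow A h - 1‖ ≤ ‖A‖ * M * h := by
  have := norm_image_sub_le_of_norm_deriv_le_segment' (f := linFlow A) (a := 0) (b := h)
    (C := ‖A‖ * M) (fun t _ => (hasDerivAt_linFlow A t).hasDerivWithinAt)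
    (fun t ht => (norm_mul_le _ _).trans (by gcongr; exact hM t ht.1)) h ⟨hh, le_rfl⟩
  simpa [linFlow_zero] using this

/-- A bounded flow in finite dimension has a limit point `S` at infinity. -/
theorem exists_limit_linFlow [FiniteDimensional ℝ X] {M : ℝ}
    (hM : ∀ t, 0 ≤ t → ‖linFlow A t‖ ≤ M) :
    ∃ S : X →L[ℝ] X, (∀ t x, S (linFlow A t x) = linFlow A t (S x)) ∧
      ∀ ε > 0, ∀ t₀, ∃ t ≥ t₀, ‖linFlow A t - S‖ ≤ ε := by
  have : ProperSpace (X →L[ℝ] X) := FiniteDimensional.proper ℝ _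
  obtain ⟨S, -, k, hk, hS⟩ := tendsto_subseq_of_bounded
    (Metric.isBounded_closedBall (x := (0 : X →L[ℝ] X)) (r := M))
    (x := fun n : ℕ => linFlow A n)
    (fun n => by rw [mem_closedBall_zero_iff]; exact hM n n.cast_nonneg)
  refine ⟨S, fun t x => ?_, fun ε hε t₀ => ?_⟩
  · have h1 : Tendsto (fun n => linFlow A (k n) (linFlow A t x)) atTop (𝓝 (S (linFlow A t x))) :=
      ((ContinuousLinearMap.apply ℝ X (linFlow A t x)).continuous.tendsto S).comp hS
    have h2 : Tendsto (fun n => linFlow A t (linFlow A (k n) x)) atTop (𝓝 (linFlow A t (S x))) :=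
      ((linFlow A t).continuous.tendsto _).comp
        (((ContinuousLinearMap.apply ℝ X x).continuous.tendsto S).comp hS)
    refine tendsto_nhds_unique (h1.congr fun n => ?_) h2
    rw [← linFlow_add_apply, ← linFlow_add_apply, add_comm]
  · have h1 : ∀ᶠ n in atTop, ‖linFlow A (k n) - S‖ < ε := by
      have := (Metric.tendsto_nhds.1 hS) ε hε
      simpa [dist_eq_norm] using this
    have h2 : ∀ᶠ n in atTop, t₀ ≤ (k n : ℝ) :=
      (tendsto_natCast_atTop_atTop.comp hk.tendsto_atTop).eventually_ge_atTop t₀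
    obtain ⟨n, hn1, hn2⟩ := (h1.and h2).exists
    exact ⟨k n, hn2, hn1.le⟩

variable {A} {M : ℝ} {S : X →L[ℝ] X}

/-- If `S (S y) = 0`, the orbit of `y` is nearly zero at some time `t + t`, hence at all later times
by boundedness; but `S y` is a limit point of the orbit at infinity. Consequently `S` is injective
on its range. -/
theorem limit_linFlow_apply_eq_zero (hM : ∀ t, 0 ≤ t → ‖linFlow A t‖ ≤ M)
    (hS : ∀ ε > 0, ∀ t₀, ∃ t ≥ t₀, ‖linFlow A t - S‖ ≤ ε) {y : X} (hy : S (S y) = 0) :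
    S y = 0 := by
  have hM0 : 0 ≤ M := (norm_nonneg _).trans (hM 0 le_rfl)
  rw [← norm_le_zero_iff]
  refine le_of_forall_pos_le_add fun ε hε => ?_
  set δ := ε / (‖y‖ + M * (M * ‖y‖ + ‖S y‖) + 1) with hδ
  have hδ0 : 0 < δ := by positivity
  obtain ⟨t, ht, h1⟩ := hS δ hδ0 0
  obtain ⟨r, hr, h2⟩ := hS δ hδ0 (t + t)
  have e0 : linFlow A r y = linFlow A (r - t - t) (linFlow A t (linFlow A t y)) := by
    rw [← linFlow_add_apply, ← linFlow_add_apply]; congr 2; ring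
  have b1 : ‖linFlow A t y - S y‖ ≤ δ * ‖y‖ :=
    ((linFlow A t - S).le_opNorm y).trans (by gcongr)
  have b2 : ‖linFlow A t (S y) - S (S y)‖ ≤ δ * ‖S y‖ :=
    ((linFlow A t - S).le_opNorm (S y)).trans (by gcongr)
  have b3 : ‖linFlow A r y - S y‖ ≤ δ * ‖y‖ :=
    ((linFlow A r - S).le_opNorm y).trans (by gcongr)
  rw [hy, sub_zero] at b2
  have b4 : ‖linFlow A t (linFlow A t y)‖ ≤ M * (δ * ‖y‖) + δ * ‖S y‖ := by
    have : linFlow A t (linFlow A t y) = linFlow A t (linFlow A t y - S y) + linFlow A t (S y) := by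
      rw [map_sub]; abel
    rw [this]
    refine (norm_add_le _ _).trans (add_le_add ?_ b2)
    exact ((linFlow A t).le_opNorm _).trans (mul_le_mul (hM t ht) b1 (norm_nonneg _) hM0)
  have b5 : ‖linFlow A r y‖ ≤ M * (M * (δ * ‖y‖) + δ * ‖S y‖) := by
    rw [e0]
    exact ((linFlow A _).le_opNorm _).trans
      (mul_le_mul (hM _ (by linarith)) b4 (norm_nonneg _) hM0)
  have b6 : ‖S y‖ ≤ ‖linFlow A r y‖ + ‖linFlow A r y - S y‖ := norm_le_insert _ _
  have b7 : δ * (‖y‖ + M * (M * ‖y‖ + ‖S y‖) + 1) = ε := by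
    rw [hδ]; field_simp
  linarith

/-- A bounded flow splits the space into the stable subspace `ker S` and the subspace `range S`, on
which the flow is bounded from below. -/
theorem exists_decomposition_linFlow [FiniteDimensional ℝ X]
    (hM : ∀ t, 0 ≤ t → ‖linFlow A t‖ ≤ M)
    (hS : ∀ ε > 0, ∀ t₀, ∃ t ≥ t₀, ‖linFlow A t - S‖ ≤ ε) :
    ∃ K > 0, ∀ x, ∃ y, S (x - S y) = 0 ∧ ‖S y‖ ≤ K * ‖x‖ ∧ ‖x - S y‖ ≤ K * ‖x‖ := by
  let S₀ : S.range →ₗ[ℝ] S.range := (S : X →ₗ[ℝ] X).restrict fun x _ => ⟨x, rfl⟩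
  have hker : S₀.ker = ⊥ := by
    rw [LinearMap.ker_eq_bot']
    rintro ⟨_, y, rfl⟩ hx
    have : S (S y) = 0 := congrArg Subtype.val hx
    exact Subtype.ext (limit_linFlow_apply_eq_zero hM hS this)
  let e : S.range ≃ₗ[ℝ] S.range := LinearEquiv.ofInjectiveEndo S₀ (LinearMap.ker_eq_bot.1 hker)
  -- `f x` is the element of the range with the same image under `S` as `x`: the projection along
  -- `ker S`.
  let f : X →L[ℝ] S.range :=
    LinearMap.toContinuousLinearMap (e.symm.toLinearMap ∘ₗ (S : X →ₗ[ℝ] X).rangeRestrict)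
  refine ⟨‖f‖ + 1, by positivity, fun x => ?_⟩
  obtain ⟨y, hy⟩ := (f x).2
  change S y = f x at hy
  have h1 : S (f x) = S x := by
    have : S₀ (f x) = (S : X →ₗ[ℝ] X).rangeRestrict x := e.apply_symm_apply _
    exact congrArg Subtype.val this
  have h2 : ‖S y‖ ≤ ‖f‖ * ‖x‖ := by rw [hy]; exact f.le_opNorm x
  refine ⟨y, ?_, ?_, ?_⟩
  · rw [map_sub, hy, h1, sub_self]
  · linarith [norm_nonneg x]
  · linarith [norm_sub_le x (S y)]

/-- An orbit that is small at time `t` stays small, and `S (S y)` is a limit point of the orbit of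
`S y`; so `‖S (S y)‖ ≤ M * ‖linFlow A t (S y)‖`. Injectivity of `S` on its range bounds `‖S y‖` by
`‖S (S y)‖`. -/
theorem exists_lower_bound_linFlow [FiniteDimensional ℝ X]
    (hM : ∀ t, 0 ≤ t → ‖linFlow A t‖ ≤ M)
    (hS : ∀ ε > 0, ∀ t₀, ∃ t ≥ t₀, ‖linFlow A t - S‖ ≤ ε) :
    ∃ k > 0, ∀ t, 0 ≤ t → ∀ y, k * ‖S y‖ ≤ ‖linFlow A t (S y)‖ := by
  have hM0 : 0 ≤ M := (norm_nonneg _).trans (hM 0 le_rfl)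
  let S₀ : S.range →ₗ[ℝ] X := (S : X →ₗ[ℝ] X) ∘ₗ S.range.subtype
  have hker : S₀.ker = ⊥ := by
    rw [LinearMap.ker_eq_bot']
    rintro ⟨_, y, rfl⟩ hx
    exact Subtype.ext (limit_linFlow_apply_eq_zero hM hS hx)
  obtain ⟨K, hK, hanti⟩ := S₀.exists_antilipschitzWith hker
  have hanti' : ∀ y, ‖S y‖ ≤ K * ‖S (S y)‖ := fun y => by
    have := hanti.le_mul_norm (x := (⟨S y, y, rfl⟩ : S.range)) (map_zero _)
    exact this
  have hK' : (0 : ℝ) < K := hK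
  refine ⟨1 / (K * (M + 1)), by positivity, fun t ht y => ?_⟩
  have h1 : ‖S (S y)‖ ≤ M * ‖linFlow A t (S y)‖ := by
    refine le_of_forall_pos_le_add fun ε hε => ?_
    obtain ⟨r, hr, h⟩ := hS (ε / (‖S y‖ + 1)) (by positivity) t
    have e1 : linFlow A r (S y) = linFlow A (r - t) (linFlow A t (S y)) := by
      rw [← linFlow_add_apply]; congr 2; ring
    have b1 : ‖linFlow A r (S y) - S (S y)‖ ≤ ε := by
      refine ((linFlow A r - S).le_opNorm (S y)).trans ?_
      calc _ ≤ ε / (‖S y‖ + 1) * ‖S y‖ := by gcongr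
        _ ≤ ε := by
          rw [div_mul_eq_mul_div, div_le_iff₀ (by positivity)]
          nlinarith [norm_nonneg (S y)]
    have b2 : ‖linFlow A r (S y)‖ ≤ M * ‖linFlow A t (S y)‖ := by
      rw [e1]
      exact ((linFlow A _).le_opNorm _).trans (by gcongr; exact hM _ (by linarith))
    linarith [norm_le_insert (linFlow A r (S y)) (S (S y))]
  have h2 : ‖S y‖ ≤ K * (M * ‖linFlow A t (S y)‖) := (hanti' y).trans (by gcongr)
  rw [div_mul_eq_mul_div, one_mul, div_le_iff₀ (by positivity)]
  nlinarith [norm_nonneg (linFlow A t (S y))]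

/-- A Lyapunov function on the stable subspace of a bounded flow. -/
theorem exists_lyapunov_linFlow (hM : ∀ t, 0 ≤ t → ‖linFlow A t‖ ≤ M)
    (hcomm : ∀ t x, S (linFlow A t x) = linFlow A t (S x))
    (hS : ∀ ε > 0, ∀ t₀, ∃ t ≥ t₀, ‖linFlow A t - S‖ ≤ ε) :
    ∃ Λ : X → ℝ, ∃ b > 0, ∃ α > 0, ∃ β > 0, Λ 0 = 0 ∧ (∀ y, b * ‖y‖ ^ 2 ≤ Λ y) ∧
      ∀ h, 0 < h → h ≤ 1 → ∀ y, S y = 0 → ∀ d,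
        Λ (linFlow A h y + d) ≤ Λ y - α * h * ‖y‖ ^ 2 + β / h * ‖d‖ ^ 2 := by
  have hM0 : 0 ≤ M := (norm_nonneg _).trans (hM 0 le_rfl)
  -- On `ker S` the time-`τ` flow contracts by one half, because it coincides there with `linFlow A
  -- τ - S`. Taking `τ ≥ 1` makes every step `h ≤ 1` fit into `[0, τ]`.
  obtain ⟨τ, hτ, hτS⟩ := hS (1 / 2) (by norm_num) 1
  obtain ⟨M₁, hM₁, hM₁b⟩ := exists_linFlow_bound A τ
  have hcont : ∀ y, Continuous fun t => ‖linFlow A t y‖ ^ 2 := fun y =>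
    (continuous_linFlow_apply A y).norm.pow 2
  have hint : ∀ y a b, IntervalIntegrable (fun t => ‖linFlow A t y‖ ^ 2) volume a b :=
    fun y a b => (hcont y).intervalIntegrable a b
  have hlow : ∀ y, ∀ t ∈ Icc 0 τ, 1 / M₁ ^ 2 * ‖y‖ ^ 2 ≤ ‖linFlow A t y‖ ^ 2 := by
    intro y t ht
    have h1 : ‖y‖ ≤ M₁ * ‖linFlow A t y‖ := by
      conv_lhs => rw [← linFlow_neg_apply A t y]
      refine ((linFlow A (-t)).le_opNorm _).trans ?_
      gcongr
      exact hM₁b _ ⟨by linarith [ht.2], by linarith [ht.1, ht.2]⟩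
    rw [div_mul_eq_mul_div, one_mul, div_le_iff₀ (by positivity), mul_comm, ← mul_pow]
    gcongr
  set Λ : X → ℝ := fun y => ∫ t in (0 : ℝ)..τ, ‖linFlow A t y‖ ^ 2 with hΛ
  have hΛlow : ∀ y, 1 / M₁ ^ 2 * ‖y‖ ^ 2 ≤ Λ y := by
    intro y
    have h1 : ∫ t in (0 : ℝ)..τ, 1 / M₁ ^ 2 * ‖y‖ ^ 2 ≤ Λ y :=
      intervalIntegral.integral_mono_on (by linarith) (by simp) (hint y 0 τ) (hlow y)
    rw [intervalIntegral.integral_const, smul_eq_mul, sub_zero] at h1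
    have h2 : 0 ≤ 1 / M₁ ^ 2 * ‖y‖ ^ 2 := by positivity
    nlinarith
  set C := τ * (M + 1) ^ 2 with hC
  have hC0 : 0 < C := by positivity
  have hΛup : ∀ y, Λ y ≤ C * ‖y‖ ^ 2 := by
    intro y
    have h1 : Λ y ≤ ∫ t in (0 : ℝ)..τ, (M + 1) ^ 2 * ‖y‖ ^ 2 := by
      refine intervalIntegral.integral_mono_on (by linarith) (hint y 0 τ) (by simp) fun t ht => ?_
      rw [← mul_pow]
      gcongr
      refine ((linFlow A t).le_opNorm y).trans ?_
      gcongr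
      linarith [hM t ht.1]
    rw [intervalIntegral.integral_const, smul_eq_mul, sub_zero] at h1
    rw [hC]; linarith
  have hyoung : ∀ ε > 0, ∀ u d, Λ (u + d) ≤ (1 + ε) * Λ u + (1 + 1 / ε) * Λ d := by
    intro ε hε u d
    simp only [hΛ]
    rw [← intervalIntegral.integral_const_mul, ← intervalIntegral.integral_const_mul,
      ← intervalIntegral.integral_add ((hint u 0 τ).const_mul _) ((hint d 0 τ).const_mul _)]
    refine intervalIntegral.integral_mono_on (by linarith) (hint _ 0 τ)
      (((hint u 0 τ).const_mul _).add ((hint d 0 τ).const_mul _)) fun t _ => ?_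
    have h1 : ‖linFlow A t (u + d)‖ ≤ ‖linFlow A t u‖ + ‖linFlow A t d‖ := by
      rw [map_add]; exact norm_add_le _ _
    set p := ‖linFlow A t u‖
    set r := ‖linFlow A t d‖
    have h2 : ‖linFlow A t (u + d)‖ ^ 2 ≤ (p + r) ^ 2 := by gcongr
    have h3 : (1 + ε) * p ^ 2 + (1 + 1 / ε) * r ^ 2 - (p + r) ^ 2 = (ε * p - r) ^ 2 / ε := by
      field_simp; ring
    have h4 : 0 ≤ (ε * p - r) ^ 2 / ε := by positivity
    linarith
  -- Moving the window of integration by `h` trades `[0, h]` for `[τ, τ + h]`, where the squared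
  -- norm is at most a quarter as large; this leaves `3 / 4` of the integral over `[0, h]`.
  set a₀ := 3 / 4 * (1 / M₁ ^ 2) with ha₀
  have ha₀0 : 0 < a₀ := by positivity
  have hdecay : ∀ h, 0 < h → h ≤ 1 → ∀ y, S y = 0 →
      Λ (linFlow A h y) ≤ Λ y - a₀ * h * ‖y‖ ^ 2 := by
    intro h h0 h1 y hy
    have e1 : Λ (linFlow A h y) = ∫ t in h..(τ + h), ‖linFlow A t y‖ ^ 2 := by
      have := intervalIntegral.integral_comp_add_right (a := 0) (b := τ)
        (fun t => ‖linFlow A t y‖ ^ 2) h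
      rw [zero_add] at this
      rw [← this]
      simp only [hΛ, linFlow_add_apply]
    have e2 : ∫ t in τ..(τ + h), ‖linFlow A t y‖ ^ 2
        = ∫ t in (0 : ℝ)..h, ‖linFlow A (τ + t) y‖ ^ 2 := by
      have := intervalIntegral.integral_comp_add_left (a := 0) (b := h)
        (fun t => ‖linFlow A t y‖ ^ 2) τ
      rw [add_zero] at this
      exact this.symm
    have e3 : (∫ t in (0 : ℝ)..h, ‖linFlow A t y‖ ^ 2) + ∫ t in h..(τ + h), ‖linFlow A t y‖ ^ 2
        = Λ y + ∫ t in τ..(τ + h), ‖linFlow A t y‖ ^ 2 := by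
      rw [intervalIntegral.integral_add_adjacent_intervals (hint _ _ _) (hint _ _ _),
        intervalIntegral.integral_add_adjacent_intervals (hint _ _ _) (hint _ _ _)]
    have e4 : ∫ t in (0 : ℝ)..h, ‖linFlow A (τ + t) y‖ ^ 2 ≤
        ∫ t in (0 : ℝ)..h, (‖linFlow A t y‖ ^ 2 - a₀ * ‖y‖ ^ 2) := by
      refine intervalIntegral.integral_mono_on h0.le ?_ ?_ fun t ht => ?_
      · exact Continuous.intervalIntegrable
          ((hcont y).comp (continuous_const.add continuous_id)) _ _
      · exact ((hint y 0 h).sub (by simp))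
      · have b1 : ‖linFlow A (τ + t) y‖ ≤ 1 / 2 * ‖linFlow A t y‖ := by
          have c1 : linFlow A (τ + t) y = (linFlow A τ - S) (linFlow A t y) := by
            rw [sub_apply, hcomm, hy, map_zero, sub_zero, linFlow_add_apply]
          rw [c1]
          exact ((linFlow A τ - S).le_opNorm _).trans (by gcongr)
        have b2 : ‖linFlow A (τ + t) y‖ ^ 2 ≤ (1 / 2 * ‖linFlow A t y‖) ^ 2 := by gcongr
        have b3 := hlow y t ⟨ht.1, by linarith [ht.2]⟩
        rw [ha₀]
        nlinarith
    rw [intervalIntegral.integral_sub (hint _ _ _) (by simp), intervalIntegral.integral_const,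
      smul_eq_mul, sub_zero] at e4
    rw [e1]
    linarith
  -- With Young's parameter `η * h`, the jump uses up half of the decay `a₀ * h * ‖y‖ ^ 2`; the
  -- price is the factor `1 / h` on `‖d‖ ^ 2`.
  set η := a₀ / (2 * C) with hη
  have hη0 : 0 < η := by positivity
  refine ⟨Λ, 1 / M₁ ^ 2, by positivity, a₀ / 2, by positivity, (1 + 1 / η) * C, by positivity,
    by simp [hΛ], hΛlow, fun h h0 h1 y hy d => ?_⟩
  have h2 := hyoung (η * h) (by positivity) (linFlow A h y) d
  have h3 := hdecay h h0 h1 y hy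
  have h4 : (1 + η * h) * Λ (linFlow A h y) ≤ (1 + η * h) * (Λ y - a₀ * h * ‖y‖ ^ 2) := by gcongr
  have h5 : η * h * Λ y ≤ η * h * (C * ‖y‖ ^ 2) := by gcongr; exact hΛup y
  have h6 : η * C = a₀ / 2 := by rw [hη]; field_simp
  have h7 : (1 + 1 / (η * h)) * Λ d ≤ (1 + 1 / η) * C / h * ‖d‖ ^ 2 := by
    have c1 : 1 + 1 / (η * h) ≤ (1 + 1 / η) / h := by
      rw [add_div, div_div]
      gcongr
      rw [le_div_iff₀ h0]; linarith
    calc (1 + 1 / (η * h)) * Λ d ≤ (1 + 1 / η) / h * (C * ‖d‖ ^ 2) := by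
          apply mul_le_mul c1 (hΛup d) _ (by positivity)
          exact le_trans (by positivity) (hΛlow d)
      _ = _ := by ring
  have h8 : 0 ≤ η * h * (a₀ * h * ‖y‖ ^ 2) := by positivity
  have h9 : η * h * (C * ‖y‖ ^ 2) = a₀ / 2 * h * ‖y‖ ^ 2 := by rw [← h6]; ring
  linarith

end Flow

/-! ### Averaging a quadratic form over a power-bounded operator -/

section InvariantForm

open Filter Topology

/-- A power-bounded operator preserves a quadratic form obtained by averaging over its powers. -/
theorem exists_invariant_quad {X : Type*} [NormedAddCommGroup X] [InnerProductSpace ℝ X]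
    {T : X → X} (hT : ∀ x y, T (x + y) = T x + T y) (hT' : ∀ (t : ℝ) x, T (t • x) = t • T x)
    {M : ℝ} (hM : ∀ j x, ‖T^[j] x‖ ≤ M * ‖x‖) :
    ∃ H : X → ℝ, IsQuad H ∧ (∀ x, H (T x) = H x) ∧ (∀ x, H x ≤ M ^ 2 * ‖x‖ ^ 2) ∧
      ∀ x m, (∀ j, m ≤ ‖T^[j] x‖ ^ 2) → m ≤ H x := by
  have hTa : ∀ (j : ℕ) x y, T^[j] (x + y) = T^[j] x + T^[j] y := by
    intro j
    induction j with
    | zero => simp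
    | succ j ih => intro x y; simp only [Function.iterate_succ_apply, hT, ih]
  have hTs : ∀ (j : ℕ) (t : ℝ) x, T^[j] (t • x) = t • T^[j] x := by
    intro j
    induction j with
    | zero => simp
    | succ j ih => intro t x; simp only [Function.iterate_succ_apply, hT', ih]
  have hTsub : ∀ (j : ℕ) x y, T^[j] (x - y) = T^[j] x - T^[j] y := by
    intro j x y
    have := hTa j (x - y) y
    rw [sub_add_cancel] at this
    rw [this, add_sub_cancel_right]
  have hsq : ∀ j x, ‖T^[j] x‖ ^ 2 ≤ M ^ 2 * ‖x‖ ^ 2 := fun j x => by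
    rw [← mul_pow]; gcongr; exact hM j x
  -- Limits of these Cesàro averages along an ultrafilter exist for every `x` and respect linear
  -- relations, so quadraticity passes to them. The averages at `T x` and `x` differ by a telescoped
  -- sum of order `1 / (N + 1)`, whence invariance.
  let avg : X → ℕ → ℝ := fun x N => (∑ j ∈ Finset.range (N + 1), ‖T^[j] x‖ ^ 2) / ((N : ℝ) + 1)
  have havg_le : ∀ x N, avg x N ≤ M ^ 2 * ‖x‖ ^ 2 := by
    intro x N
    rw [div_le_iff₀ (by positivity)]
    calc _ ≤ ∑ j ∈ Finset.range (N + 1), M ^ 2 * ‖x‖ ^ 2 := Finset.sum_le_sum fun j _ => hsq j x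
      _ = _ := by simp; ring
  have havg_ge : ∀ x m, (∀ j, m ≤ ‖T^[j] x‖ ^ 2) → ∀ N, m ≤ avg x N := by
    intro x m hm N
    rw [le_div_iff₀ (by positivity)]
    calc _ = ∑ j ∈ Finset.range (N + 1), m := by simp; ring
      _ ≤ _ := Finset.sum_le_sum fun j _ => hm j
  have hlim : ∀ x, ∃ l, Tendsto (avg x) (hyperfilter ℕ : Filter ℕ) (𝓝 l) := by
    intro x
    obtain ⟨l, -, hl⟩ := (isCompact_Icc (a := (0 : ℝ)) (b := M ^ 2 * ‖x‖ ^ 2)).ultrafilter_le_nhds'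
      ((hyperfilter ℕ).map (avg x)) (by
        rw [Ultrafilter.mem_map]
        exact univ_mem' fun N => ⟨havg_ge x 0 (fun j => by positivity) N, havg_le x N⟩)
    exact ⟨l, hl⟩
  choose H hH using hlim
  refine ⟨H, ⟨fun t x => ?_, fun x y => ?_⟩, fun x => ?_, fun x => ?_, fun x m hm => ?_⟩
  · refine tendsto_nhds_unique (hH (t • x)) (((hH x).const_mul (t ^ 2)).congr fun N => ?_)
    simp only [avg]
    rw [← mul_div_assoc, Finset.mul_sum]
    congr 1
    refine Finset.sum_congr rfl fun j _ => ?_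
    rw [hTs, norm_smul, mul_pow, Real.norm_eq_abs, sq_abs]
  · refine tendsto_nhds_unique ((hH (x + y)).add (hH (x - y)))
      ((((hH x).const_mul 2).add ((hH y).const_mul 2)).congr fun N => ?_)
    simp only [avg]
    rw [← mul_div_assoc, ← mul_div_assoc, ← add_div, ← add_div, Finset.mul_sum, Finset.mul_sum,
      ← Finset.sum_add_distrib, ← Finset.sum_add_distrib]
    congr 1
    refine Finset.sum_congr rfl fun j _ => ?_
    rw [hTa, hTsub]
    exact (isQuad_norm_sq.parallelogram _ _).symm
  · have h1 : Tendsto (fun N => avg (T x) N - avg x N) (hyperfilter ℕ : Filter ℕ) (𝓝 0) := by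
      have h2 : ∀ N, |avg (T x) N - avg x N| ≤ M ^ 2 * ‖x‖ ^ 2 * (1 / ((N : ℝ) + 1)) := by
        intro N
        have e : avg (T x) N - avg x N = (‖T^[N + 1] x‖ ^ 2 - ‖x‖ ^ 2) / ((N : ℝ) + 1) := by
          simp only [avg]
          rw [← sub_div, ← Finset.sum_sub_distrib]
          congr 1
          have := Finset.sum_range_sub (fun j => ‖T^[j] x‖ ^ 2) (N + 1)
          simpa [Function.iterate_succ_apply] using this
        rw [e, abs_div, abs_of_pos (by positivity : (0 : ℝ) < N + 1), mul_one_div]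
        gcongr
        rw [abs_le]
        have := hsq 0 x
        simp only [Function.iterate_zero, id_eq] at this
        constructor <;> nlinarith [hsq (N + 1) x, sq_nonneg ‖T^[N + 1] x‖, sq_nonneg ‖x‖]
      have h3 : Tendsto (fun N : ℕ => M ^ 2 * ‖x‖ ^ 2 * (1 / ((N : ℝ) + 1)))
          (hyperfilter ℕ : Filter ℕ) (𝓝 0) := by
        have := (tendsto_one_div_add_atTop_nhds_zero_nat (𝕜 := ℝ)).const_mul (M ^ 2 * ‖x‖ ^ 2)
        rw [mul_zero] at this
        exact this.mono_left Nat.hyperfilter_le_atTop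
      exact squeeze_zero_norm h2 h3
    have h4 := (hH (T x)).sub (hH x)
    linarith [tendsto_nhds_unique h4 h1]
  · exact le_of_tendsto (hH x) (Eventually.of_forall (havg_le x))
  · exact ge_of_tendsto (hH x) (Eventually.of_forall (havg_ge x m hm))

end InvariantForm

/-! ### Storage for the sampled system, with bounds independent of the step -/

section Uniform

variable {X U : Type*} [NormedAddCommGroup X] [InnerProductSpace ℝ X] [FiniteDimensional ℝ X]
  [AddCommGroup U] [Module ℝ U]

theorem iterate_linFlow (A : X →L[ℝ] X) (h : ℝ) (j : ℕ) (x : X) :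
    (linFlow A h)^[j] x = linFlow A (j * h) x := by
  induction j with
  | zero => simp [linFlow_zero]
  | succ j ih =>
    rw [Function.iterate_succ_apply', ih, ← linFlow_add_apply]
    congr 2
    push_cast
    ring

/-- Steering from `exp (-A) r` to `r + e` in unit time by equal jumps in the subspace `E`. -/
theorem exists_jump_path (A : X →L[ℝ] X) {φ : X × U →ₗ[ℝ] X} {q : X × U → ℝ}
    {P : X →L[ℝ] X →L[ℝ] ℝ} {E : Submodule ℝ X} {h K g G M₁ ρ : ℝ} (hh0 : 0 < h)
    (hφ : ∀ x, φ (x, 0) = linFlow A h x) (hK : 0 ≤ K)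
    (hσ : ∀ y, q (y, 0) - P (φ (y, 0)) (φ (y, 0)) + P y y ≤ K * h * ‖y‖ ^ 2)
    (hE : ∀ t, ∀ y ∈ E, linFlow A t y ∈ E) (hg0 : 0 ≤ g) (hg : g * h ≤ G) (hM₁ : 0 ≤ M₁)
    (hM₁b : ∀ t ∈ Set.Icc (-1) 1, ‖linFlow A t‖ ≤ M₁) {r e : X} (he : e ∈ E) (hrρ : ‖r‖ ≤ ρ)
    (heρ : ‖e‖ ≤ ρ) (j : ℕ) (hj : (j : ℝ) * h ≤ 1) :
    ∃ a, Reach (jumpStep φ E) (jumpCost φ q P E g) j (linFlow A (-1) r)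
        (linFlow A (j * h - 1) (r + ((j : ℝ) * h) • e)) a ∧
      a ≤ j * h * ((4 * K + G) * (M₁ * ρ) ^ 2) + P (linFlow A (j * h - 1) (r + ((j : ℝ) * h) • e))
        (linFlow A (j * h - 1) (r + ((j : ℝ) * h) • e)) -
          P (linFlow A (-1) r) (linFlow A (-1) r) := by
  have hρ : 0 ≤ ρ := (norm_nonneg _).trans hrρ
  induction j with
  | zero =>
    refine ⟨0, ?_, ?_⟩
    · simpa using Reach.refl (linFlow A (-1) r)
    · simp
  | succ j ih =>
    have hs' : ((j + 1 : ℕ) : ℝ) * h = j * h + h := by push_cast; ring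
    rw [hs'] at hj ⊢
    obtain ⟨a, hra, ha⟩ := ih (by linarith)
    have hs0 : 0 ≤ (j : ℝ) * h := by positivity
    generalize (j : ℝ) * h = s at *
    set p := linFlow A (s - 1) (r + s • e) with hp
    set p' := linFlow A (s + h - 1) (r + (s + h) • e) with hp'
    -- In coordinates moving with the flow, each jump adds `h • e`. Its penalty is `O(g * h ^ 2) =
    -- O(h)`, so the total over unit time stays bounded, and the changes of `P` telescope.
    set d : E := ⟨h • linFlow A (s + h - 1) e, E.smul_mem h (hE _ e he)⟩ with hd
    have hstep : jumpStep φ E (p, (0, d)) = p' := by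
      rw [jumpStep_apply, hφ, hp, hp']
      change linFlow A h (linFlow A (s - 1) (r + s • e)) + h • linFlow A (s + h - 1) e = _
      rw [← linFlow_add_apply, ← map_smul, show h + (s - 1) = s + h - 1 by ring, ← map_add]
      congr 1
      module
    refine ⟨_, (hra.step (0, d)).cast hstep rfl, ?_⟩
    have hdn : ‖(d : X)‖ ≤ h * (M₁ * ρ) := by
      rw [hd]
      simp only
      rw [norm_smul, Real.norm_eq_abs, abs_of_pos hh0]
      gcongr
      calc _ ≤ ‖linFlow A (s + h - 1)‖ * ‖e‖ := (linFlow A _).le_opNorm _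
        _ ≤ M₁ * ρ := by
          gcongr
          exact hM₁b _ ⟨by linarith, by linarith⟩
    have hpn : ‖p‖ ≤ M₁ * (2 * ρ) := by
      have b1 : ‖r + s • e‖ ≤ 2 * ρ := by
        have := norm_add_le r (s • e)
        rw [norm_smul, Real.norm_eq_abs, abs_of_nonneg hs0] at this
        nlinarith [norm_nonneg e]
      calc ‖p‖ ≤ ‖linFlow A (s - 1)‖ * ‖r + s • e‖ := (linFlow A (s - 1)).le_opNorm _
        _ ≤ M₁ * (2 * ρ) := by
          gcongr
          exact hM₁b _ ⟨by linarith, by linarith⟩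
    have b1 : g * ‖(d : X)‖ ^ 2 ≤ h * (G * (M₁ * ρ) ^ 2) := by
      calc g * ‖(d : X)‖ ^ 2 ≤ g * (h * (M₁ * ρ)) ^ 2 := by gcongr
        _ = g * h * (h * (M₁ * ρ) ^ 2) := by ring
        _ ≤ G * (h * (M₁ * ρ) ^ 2) := by gcongr
        _ = _ := by ring
    have b2 : K * h * ‖p‖ ^ 2 ≤ h * (4 * K * (M₁ * ρ) ^ 2) := by
      calc K * h * ‖p‖ ^ 2 ≤ K * h * (M₁ * (2 * ρ)) ^ 2 := by gcongr
        _ = _ := by ring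
    have b3 := hσ p
    have b4 : jumpCost φ q P E g (p, (0, d)) = q (p, 0) + P p' p' -
        P (φ (p, 0)) (φ (p, 0)) + g * ‖(d : X)‖ ^ 2 := by
      rw [jumpCost, hstep]
    rw [b4, add_mul s h]
    linarith

/-- A sampled linear system whose cost is bounded below in terms of the endpoints has a positive
definite quadratic storage function, with bounds that do not depend on the sampling rate. -/
theorem exists_sampled_storage (A : X →L[ℝ] X) {c κ : ℝ} (hc : 0 < c) (hκ : 0 ≤ κ)
    (hA : ∀ t, 0 ≤ t → ∀ x, c * ‖linFlow A t x‖ ^ 2 ≤ κ * ‖x‖ ^ 2) :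
    ∃ c' > 0, ∃ C, ∀ (n : ℕ) (φ : X × U →ₗ[ℝ] X) (q : X × U → ℝ), IsQuad q →
      (∀ x, q (x, 0) ≤ 0) → (∀ x, φ (x, 0) = linFlow A (1 / ((n : ℝ) + 1)) x) →
      (∀ N x y a, Reach φ q N x y a → c * ‖y‖ ^ 2 - κ * ‖x‖ ^ 2 ≤ a) →
      ∃ B : X →L[ℝ] X →L[ℝ] ℝ, (∀ x y, B x y = B y x) ∧
        (∀ x y, |B x y| ≤ C * (‖x‖ * ‖y‖)) ∧ (∀ x, c' * ‖x‖ ^ 2 ≤ B x x) ∧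
        ∀ z, B (φ z) (φ z) - B z.1 z.1 ≤ q z := by
  set M := Real.sqrt (κ / c) with hMdef
  have hM0 : 0 ≤ M := Real.sqrt_nonneg _
  have hMx : ∀ t, 0 ≤ t → ∀ x, ‖linFlow A t x‖ ≤ M * ‖x‖ := by
    intro t ht x
    refine le_of_sq_le_sq ?_ (by positivity)
    rw [mul_pow, hMdef, Real.sq_sqrt (by positivity), div_mul_eq_mul_div, le_div_iff₀ hc, mul_comm]
    exact hA t ht x
  have hM : ∀ t, 0 ≤ t → ‖linFlow A t‖ ≤ M := fun t ht =>
    ContinuousLinearMap.opNorm_le_bound _ hM0 (hMx t ht)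
  obtain ⟨S, hcomm, hS⟩ := exists_limit_linFlow A hM
  obtain ⟨D, hD, hdec⟩ := exists_decomposition_linFlow hM hS
  obtain ⟨k, hk, hklow⟩ := exists_lower_bound_linFlow hM hS
  obtain ⟨Λ, b, hb, α, hα, β, hβ, hΛ0, hΛb, hΛ⟩ := exists_lyapunov_linFlow hM hcomm hS
  obtain ⟨M₁, hM₁, hM₁b⟩ := exists_linFlow_bound A 1
  -- `K * h` bounds the loss of `P` in a free step: `P y y - P w w = P (y - w) (y + w)`, and `y - w`
  -- is `O(h)`. The two summands of `L` meet the two lower bounds on `L` in `le_of_reach_jump`.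
  set K := 2 * κ * (‖A‖ * M * (M + 1)) with hK
  have hK0 : 0 ≤ K := by positivity
  set L := 2 * K / α + (2 * κ + c) / b with hL
  have hL0 : 0 ≤ L := by positivity
  set Q := (4 * K + L * β / 2) * (M₁ * D) ^ 2 with hQ
  have hQ0 : 0 ≤ Q := by positivity
  set C := κ / k ^ 2 * (M ^ 2 * (M₁ * D) ^ 2) + Q + κ with hC
  have hC0 : 0 ≤ C := by positivity
  refine ⟨c / 4, by positivity, 2 * C, fun n φ q hq hq0 hφ hstar => ?_⟩
  set h : ℝ := 1 / ((n : ℝ) + 1) with hh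
  have hh0 : 0 < h := by positivity
  have hh1 : h ≤ 1 := by
    rw [hh, div_le_one (by positivity)]
    linarith [n.cast_nonneg (α := ℝ)]
  have hnh : ((n + 1 : ℕ) : ℝ) * h = 1 := by
    rw [hh]; push_cast; field_simp
  obtain ⟨P, hPn, hPs, hP0, hPκ, hP⟩ := exists_available_storage hq hq0 hκ
    (fun N x y a hr => by
      have := hstar N x y a hr
      have h2 : 0 ≤ c * ‖y‖ ^ 2 := by positivity
      linarith)
  have hσ : ∀ y, q (y, 0) - P (φ (y, 0)) (φ (y, 0)) + P y y ≤ K * h * ‖y‖ ^ 2 := by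
    intro y
    rw [hφ]
    set w := linFlow A h y with hw
    have e1 : P y y - P w w = P (y - w) (y + w) := by
      simp only [map_sub, map_add, sub_apply]
      rw [hPs w y]; ring
    have b1 : ‖y - w‖ ≤ ‖A‖ * M * h * ‖y‖ := by
      have := (linFlow A h - 1).le_opNorm y
      rw [norm_sub_rev]
      exact this.trans (by gcongr; exact norm_linFlow_sub_one_le A hM hh0.le)
    have b2 : ‖y + w‖ ≤ (M + 1) * ‖y‖ := by
      linarith [norm_add_le y w, hMx h hh0.le y]
    have b3 := (le_abs_self _).trans (hPn (y - w) (y + w))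
    have b4 : 2 * κ * (‖y - w‖ * ‖y + w‖) ≤
        2 * κ * ((‖A‖ * M * h * ‖y‖) * ((M + 1) * ‖y‖)) := by gcongr
    have e2 : 2 * κ * ((‖A‖ * M * h * ‖y‖) * ((M + 1) * ‖y‖)) = K * h * ‖y‖ ^ 2 := by
      rw [hK]; ring
    linarith [hq0 y]
  set E : Submodule ℝ X := (S : X →ₗ[ℝ] X).ker with hE
  have memE : ∀ y, y ∈ E ↔ S y = 0 := fun y => LinearMap.mem_ker
  have hEinv : ∀ t, ∀ y ∈ E, linFlow A t y ∈ E := fun t y hy => by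
    rw [memE] at hy ⊢
    rw [hcomm, hy, map_zero]
  -- A penalty of order `1 / h` is large enough to absorb the `β / h` of the Lyapunov estimate, and
  -- small enough that `n + 1` jumps of size `O(h)` have bounded total cost.
  set g := L * β / (2 * h) with hg
  have hlow : ∀ N x₀ x a, Reach (jumpStep φ E) (jumpCost φ q P E g) N x₀ x a →
      c / 4 * ‖x‖ ^ 2 - κ * ‖x₀‖ ^ 2 ≤ a := fun N x₀ x a hr =>
    le_of_reach_jump hq hstar hc.le hP0 hPκ hP
      (fun y hy => by rw [hφ]; exact hEinv h y hy) (α := α * h) (β := β / h) hΛ0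
      (fun y _ => hΛb y)
      (fun y hy d _ => by rw [hφ]; exact hΛ h hh0 hh1 y ((memE y).1 hy) d) hσ hL0
      (by
        have : 2 * K ≤ L * α := by
          have h1 : 2 * K = 2 * K / α * α := by field_simp
          have h2 : 0 ≤ (2 * κ + c) / b * α := by positivity
          rw [hL, add_mul]; linarith
        nlinarith)
      (by
        have h1 : 2 * κ + c = (2 * κ + c) / b * b := by field_simp
        have h2 : 0 ≤ 2 * K / α * b := by positivity
        rw [hL, add_mul]; linarith)
      (by rw [hg]; apply le_of_eq; field_simp) hr
  obtain ⟨H, hHq, hHinv, hHup, hHlow⟩ := exists_invariant_quad (T := linFlow A h)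
    (map_add _) (map_smul _) (M := M) (fun j x => by
      rw [iterate_linFlow]; exact hMx _ (by positivity) x)
  have hzero : ∀ x, jumpStep φ E (x, 0) = linFlow A h x := fun x => by
    have := jumpStep_apply φ E x 0 0
    rw [hφ, ZeroMemClass.coe_zero, add_zero] at this
    exact this
  obtain ⟨B, hBs, hBn, hBc, hB⟩ := exists_required_supply (isQuad_jumpCost φ hq P E g)
    (fun x => (jumpCost_zero φ q P E g x 0).trans_le (hq0 x)) (S : X →ₗ[ℝ] X).range
    (fun x hx => by
      obtain ⟨y, rfl⟩ := hx
      refine ⟨S (linFlow A (-h) y), ⟨_, rfl⟩, ?_⟩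
      rw [hzero, hcomm]
      exact linFlow_apply_neg A h _)
    -- On `range S` the form `H` is at least `k ^ 2 * ‖·‖ ^ 2`; the factor `κ / k ^ 2` thus makes
    -- the initial cost cancel the term `-κ * ‖x₀‖ ^ 2` of `hlow`.
    (hHq.const_mul (κ / k ^ 2)) (fun x => by rw [hzero, hHinv]) (c := c / 4) (C := C)
    (by positivity) hC0
    (fun N x₀ x a hx₀ hr => by
      obtain ⟨y, rfl⟩ := hx₀
      have h1 := hlow _ _ _ _ hr
      have h2 : k ^ 2 * ‖S y‖ ^ 2 ≤ H (S y) := hHlow _ _ fun j => by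
        rw [iterate_linFlow, ← mul_pow]
        gcongr
        exact hklow _ (by positivity) y
      have h3 : κ * ‖S y‖ ^ 2 ≤ κ / k ^ 2 * H (S y) := by
        calc κ * ‖S y‖ ^ 2 = κ / k ^ 2 * (k ^ 2 * ‖S y‖ ^ 2) := by field_simp
          _ ≤ _ := by gcongr
      change c / 4 * ‖x‖ ^ 2 - κ * ‖S y‖ ^ 2 ≤ a at h1
      change c / 4 * ‖x‖ ^ 2 ≤ κ / k ^ 2 * H (S y) + a
      linarith)
    (fun x => by
      obtain ⟨y, hy, hr, he⟩ := hdec x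
      set r := S y with hrdef
      set e := x - r with hedef
      -- Every `x = r + e` is reached in unit time from `linFlow A (-1) r`, which lies in `range S`,
      -- with `e` built up by the jumps.
      obtain ⟨a, hra, ha⟩ := exists_jump_path A hh0 hφ hK0 hσ hEinv (G := L * β / 2) (g := g)
        (by positivity) (by rw [hg]; apply le_of_eq; field_simp) hM₁.le hM₁b ((memE e).2 hy)
        hr he (n + 1) hnh.le
      rw [hnh, sub_self, linFlow_zero, one_smul] at hra ha
      have hp1 : (1 : X →L[ℝ] X) (r + e) = x := by rw [hedef]; simp
      rw [hp1] at hra ha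
      have hp0n : ‖linFlow A (-1) r‖ ≤ M₁ * (D * ‖x‖) :=
        ((linFlow A _).le_opNorm _).trans
          (mul_le_mul (hM₁b _ ⟨le_rfl, by norm_num⟩) hr (norm_nonneg _) hM₁.le)
      refine ⟨n + 1, _, ⟨linFlow A (-1) y, hcomm _ _⟩, a, hra, ?_⟩
      have b1 : κ / k ^ 2 * H (linFlow A (-1) r) ≤
          κ / k ^ 2 * (M ^ 2 * (M₁ * (D * ‖x‖)) ^ 2) := by
        gcongr
        exact (hHup _).trans (by gcongr)
      have b2 := hPκ x
      have b3 := hP0 (linFlow A (-1) r)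
      have b4 : C * ‖x‖ ^ 2 = κ / k ^ 2 * (M ^ 2 * (M₁ * (D * ‖x‖)) ^ 2) +
          (4 * K + L * β / 2) * (M₁ * (D * ‖x‖)) ^ 2 + κ * ‖x‖ ^ 2 := by rw [hC, hQ]; ring
      linarith)
  refine ⟨B, hBs, hBn, hBc, fun z => ?_⟩
  have := hB (z.1, (z.2, 0))
  rw [jumpCost_zero, jumpStep_apply] at this
  simpa using this

end Uniform

/-! ### From a general storage function to a quadratic one -/

section ContinuousTime

open Filter Topology

/-- If `x` is small relative to `y`, scaling puts `y` on the unit sphere, where `V` is bounded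
below, and `x` near zero, where `V` is small; otherwise it puts `x` on the sphere, where `V` is
bounded above. The factor `l` may depend on the pair, since it is applied to one path at a time. -/
theorem exists_scaled_bound {X : Type*} [NormedAddCommGroup X] [NormedSpace ℝ X]
    [FiniteDimensional ℝ X] {V : X → ℝ} (hV : Continuous V) (hV0 : V 0 = 0)
    (hpos : ∀ x, x ≠ 0 → 0 < V x) :
    ∃ c > 0, ∃ κ ≥ 0, ∀ x y, ∃ l : ℝ, 0 < l ∧
      l ^ 2 * (c * ‖y‖ ^ 2 - κ * ‖x‖ ^ 2) ≤ V (l • y) - V (l • x) := by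
  have : ProperSpace X := FiniteDimensional.proper ℝ X
  have hnn : ∀ x, 0 ≤ V x := fun x => by
    rcases eq_or_ne x 0 with rfl | hx
    · exact hV0.ge
    · exact (hpos x hx).le
  obtain ⟨c₀, hc₀, hlow⟩ : ∃ c₀ > 0, ∀ x, ‖x‖ = 1 → c₀ ≤ V x := by
    rcases (Metric.sphere (0 : X) 1).eq_empty_or_nonempty with he | hne
    · refine ⟨1, one_pos, fun x hx => ?_⟩
      have : x ∈ Metric.sphere (0 : X) 1 := by simpa using hx
      rw [he] at this
      exact this.elim
    · obtain ⟨x₀, hx₀, hmin⟩ := (isCompact_sphere (0 : X) 1).exists_isMinOn hne hV.continuousOn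
      refine ⟨V x₀, hpos x₀ ?_, fun x hx => hmin (by simpa using hx)⟩
      rintro rfl
      simp at hx₀
  obtain ⟨C₀, hup⟩ := (isCompact_sphere (0 : X) 1).exists_bound_of_continuousOn hV.continuousOn
  have hup' : ∀ x, ‖x‖ = 1 → V x ≤ |C₀| := fun x hx =>
    (le_abs_self _).trans ((hup x (by simpa using hx)).trans (le_abs_self _))
  obtain ⟨δ, hδ, hsmall⟩ : ∃ δ > 0, ∀ x, ‖x‖ ≤ δ → V x ≤ c₀ / 2 := by
    have h1 : ∀ᶠ x in 𝓝 (0 : X), V x < c₀ / 2 :=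
      (hV.tendsto 0).eventually_lt_const (by rw [hV0]; positivity)
    obtain ⟨ε, hε, h⟩ := Metric.eventually_nhds_iff_ball.1 h1
    refine ⟨ε / 2, by positivity, fun x hx => (h x ?_).le⟩
    rw [mem_ball_zero_iff]; linarith
  refine ⟨c₀ / 2, by positivity, |C₀| + c₀ / 2 / δ ^ 2, by positivity, fun x y => ?_⟩
  by_cases hxy : ‖x‖ ≤ δ * ‖y‖
  · rcases eq_or_ne y 0 with rfl | hy
    · have hx : x = 0 := by
        rw [norm_zero, mul_zero] at hxy
        exact norm_le_zero_iff.1 hxy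
      subst hx
      exact ⟨1, one_pos, by simp⟩
    · have hy' : 0 < ‖y‖ := norm_pos_iff.2 hy
      refine ⟨‖y‖⁻¹, by positivity, ?_⟩
      have h1 : ‖‖y‖⁻¹ • y‖ = 1 := by
        rw [norm_smul, norm_inv, norm_norm, inv_mul_cancel₀ hy'.ne']
      have h2 : ‖‖y‖⁻¹ • x‖ ≤ δ := by
        rw [norm_smul, norm_inv, norm_norm, inv_mul_le_iff₀ hy']; linarith
      have h3 := hlow _ h1
      have h4 := hsmall _ h2
      have h5 : ‖y‖⁻¹ ^ 2 * (c₀ / 2 * ‖y‖ ^ 2) = c₀ / 2 := by field_simp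
      have h6 : 0 ≤ ‖y‖⁻¹ ^ 2 * ((|C₀| + c₀ / 2 / δ ^ 2) * ‖x‖ ^ 2) := by positivity
      rw [mul_sub]
      linarith
  · push Not at hxy
    have hx' : 0 < ‖x‖ := lt_of_le_of_lt (by positivity) hxy
    refine ⟨‖x‖⁻¹, by positivity, ?_⟩
    have h1 : ‖‖x‖⁻¹ • x‖ = 1 := by
      rw [norm_smul, norm_inv, norm_norm, inv_mul_cancel₀ hx'.ne']
    have h2 := hup' _ h1
    have h3 : c₀ / 2 * ‖y‖ ^ 2 ≤ c₀ / 2 / δ ^ 2 * ‖x‖ ^ 2 := by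
      have : (δ * ‖y‖) ^ 2 ≤ ‖x‖ ^ 2 := by gcongr
      calc c₀ / 2 * ‖y‖ ^ 2 = c₀ / 2 / δ ^ 2 * (δ * ‖y‖) ^ 2 := by field_simp
        _ ≤ _ := by gcongr
    have h4 : ‖x‖⁻¹ ^ 2 * (c₀ / 2 * ‖y‖ ^ 2 - (|C₀| + c₀ / 2 / δ ^ 2) * ‖x‖ ^ 2) ≤
        ‖x‖⁻¹ ^ 2 * (-(|C₀| * ‖x‖ ^ 2)) := by
      gcongr
      linarith
    have h5 : ‖x‖⁻¹ ^ 2 * (-(|C₀| * ‖x‖ ^ 2)) = -|C₀| := by field_simp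
    linarith [hnn (‖x‖⁻¹ • y)]

theorem tendsto_slope_nat {Y : Type*} [NormedAddCommGroup Y] [NormedSpace ℝ Y] {f : ℝ → Y} {f' : Y}
    (hf : HasDerivAt f f' 0) :
    Tendsto (fun n : ℕ => ((n : ℝ) + 1) • (f (1 / ((n : ℝ) + 1)) - f 0)) atTop (𝓝 f') := by
  have h1 := hasDerivAt_iff_tendsto_slope_zero.1 hf
  have h2 : Tendsto (fun n : ℕ => 1 / ((n : ℝ) + 1)) atTop (𝓝[≠] 0) :=
    tendsto_nhdsWithin_iff.2 ⟨tendsto_one_div_add_atTop_nhds_zero_nat,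
      Eventually.of_forall fun n => by
        simp only [Set.mem_compl_iff, Set.mem_singleton_iff]; positivity⟩
  refine (h1.comp h2).congr fun n => ?_
  simp

variable {X U : Type*} [NormedAddCommGroup X] [InnerProductSpace ℝ X] [FiniteDimensional ℝ X]
  [NormedAddCommGroup U] [NormedSpace ℝ U]

/-- The state at time `t` as a function of the initial state and a constant input. -/
noncomputable def constFlow (A : X →L[ℝ] X) (B : U →L[ℝ] X) (t : ℝ) : X × U →L[ℝ] X :=
  linFlow A t ∘L ContinuousLinearMap.fst ℝ X U +
    (∫ s in (0 : ℝ)..t, linFlow A s) ∘L B ∘L ContinuousLinearMap.snd ℝ X U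

omit [FiniteDimensional ℝ X] in
theorem constFlow_apply (A : X →L[ℝ] X) (B : U →L[ℝ] X) (t : ℝ) (z : X × U) :
    constFlow A B t z = linFlow A t z.1 + (∫ s in (0 : ℝ)..t, linFlow A s) (B z.2) := rfl

omit [FiniteDimensional ℝ X] in
theorem constFlow_zero (A : X →L[ℝ] X) (B : U →L[ℝ] X) (z : X × U) :
    constFlow A B 0 z = z.1 := by
  simp [constFlow_apply, linFlow_zero]

theorem hasDerivAt_constFlow (A : X →L[ℝ] X) (B : U →L[ℝ] X) (z : X × U) (t : ℝ) :
    HasDerivAt (fun t => constFlow A B t z) (A (constFlow A B t z) + B z.2) t := by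
  have : CompleteSpace X := FiniteDimensional.complete ℝ X
  have hint : ∀ a b, IntervalIntegrable (linFlow A) volume a b := fun a b =>
    (continuous_linFlow A).intervalIntegrable a b
  have h1 : HasDerivAt (fun t => ∫ s in (0 : ℝ)..t, linFlow A s) (linFlow A t) t :=
    intervalIntegral.integral_hasDerivAt_right (hint 0 t)
      ((continuous_linFlow A).stronglyMeasurableAtFilter _ _) (continuous_linFlow A).continuousAt
  have h2 : HasDerivAt (fun t => (∫ s in (0 : ℝ)..t, linFlow A s) (B z.2))
      (linFlow A t (B z.2)) t :=
    (ContinuousLinearMap.apply ℝ X (B z.2)).hasFDerivAt.comp_hasDerivAt t h1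
  have h3 : A ((∫ s in (0 : ℝ)..t, linFlow A s) (B z.2)) = linFlow A t (B z.2) - B z.2 := by
    rw [ContinuousLinearMap.intervalIntegral_apply (hint 0 t),
      ← ContinuousLinearMap.intervalIntegral_comp_comm _
        ((continuous_linFlow_apply A _).intervalIntegrable 0 t),
      intervalIntegral.integral_eq_sub_of_hasDerivAt
        (fun s _ => hasDerivAt_linFlow_apply A (B z.2) s)
        ((A.continuous.comp (continuous_linFlow_apply A _)).intervalIntegrable 0 t), linFlow_zero]
    simp
  have h4 := (hasDerivAt_linFlow_apply A z.1 t).add h2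
  refine h4.congr_deriv ?_
  rw [constFlow_apply, map_add, h3]
  abel

/-- A linear system with a quadratic supply rate that has a continuous positive definite storage
function has a positive definite quadratic one. -/
theorem exists_quadratic_storage (A : X →L[ℝ] X) (B : U →L[ℝ] X) {s : X × U → ℝ}
    (hs : IsQuad s) (hsc : Continuous s) (hs0 : ∀ x, s (x, 0) ≤ 0) {V : X → ℝ}
    (hVc : Continuous V) (hV0 : V 0 = 0) (hVpos : ∀ x, x ≠ 0 → 0 < V x)
    (hV : ∀ (x : ℝ → X) (u : U), (∀ t, HasDerivAt x (A (x t) + B u) t) → ∀ h, 0 ≤ h →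
      V (x h) - V (x 0) ≤ ∫ t in (0 : ℝ)..h, s (x t, u)) :
    ∃ P : X →L[ℝ] X →L[ℝ] ℝ, (∀ x y, P x y = P y x) ∧ (∀ x, x ≠ 0 → 0 < P x x) ∧
      ∀ x u, 2 * P x (A x + B u) ≤ s (x, u) := by
  have : CompleteSpace X := FiniteDimensional.complete ℝ X
  obtain ⟨c, hc, κ, hκ, hscale⟩ := exists_scaled_bound hVc hV0 hVpos
  have hflowc : ∀ z, Continuous fun t => constFlow A B t z := fun z =>
    continuous_iff_continuousAt.2 fun t => (hasDerivAt_constFlow A B z t).continuousAt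
  have hsflow : ∀ z, Continuous fun t => s (constFlow A B t z, z.2) := fun z =>
    hsc.comp ((hflowc z).prodMk continuous_const)
  have hint : ∀ z h, IntervalIntegrable (fun t => s (constFlow A B t z, z.2)) volume 0 h :=
    fun z h => (hsflow z).intervalIntegrable 0 h
  set q : ℝ → X × U → ℝ := fun h z => ∫ t in (0 : ℝ)..h, s (constFlow A B t z, z.2) with hq
  have hVflow : ∀ h, 0 ≤ h → ∀ z, V (constFlow A B h z) - V z.1 ≤ q h z := fun h hh z => by
    have := hV (fun t => constFlow A B t z) z.2 (hasDerivAt_constFlow A B z) h hh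
    simpa only [constFlow_zero] using this
  have hq0 : ∀ h, 0 ≤ h → ∀ x, q h (x, 0) ≤ 0 := fun h hh x => by
    have := intervalIntegral.integral_mono_on hh (hint (x, 0) h)
      (intervalIntegrable_const (c := (0 : ℝ))) fun t _ => hs0 (constFlow A B t (x, 0))
    simpa using this
  have hqq : ∀ h, IsQuad (q h) := by
    intro h
    refine ⟨fun t z => ?_, fun z z' => ?_⟩
    · simp only [hq]
      rw [← intervalIntegral.integral_const_mul]
      congr 1
      ext r
      rw [← hs.smul, map_smul]
      rfl
    · simp only [hq]
      rw [← intervalIntegral.integral_add (hint _ _) (hint _ _),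
        ← intervalIntegral.integral_const_mul, ← intervalIntegral.integral_const_mul,
        ← intervalIntegral.integral_add ((hint _ _).const_mul _) ((hint _ _).const_mul _)]
      congr 1
      ext r
      rw [← hs.parallelogram, map_add, map_sub]
      rfl
  have hfree : ∀ t x, constFlow A B t (x, 0) = linFlow A t x := fun t x => by
    simp [constFlow_apply]
  -- Free motion has nonpositive cost, so the lower bound on costs limits the growth of the flow.
  have hA : ∀ t, 0 ≤ t → ∀ x, c * ‖linFlow A t x‖ ^ 2 ≤ κ * ‖x‖ ^ 2 := by
    intro t ht x
    obtain ⟨l, hl, hle⟩ := hscale x (linFlow A t x)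
    have h1 := hVflow t ht (l • x, 0)
    rw [hfree, map_smul] at h1
    have h2 := hq0 t ht (l • x)
    simp only at h1
    have h3 : l ^ 2 * (c * ‖linFlow A t x‖ ^ 2 - κ * ‖x‖ ^ 2) ≤ 0 := by linarith
    have h4 := nonpos_of_mul_nonpos_right h3 (by positivity)
    linarith
  have hstar : ∀ h, 0 ≤ h → ∀ N x y a, Reach (constFlow A B h : X × U →ₗ[ℝ] X) (q h) N x y a →
      c * ‖y‖ ^ 2 - κ * ‖x‖ ^ 2 ≤ a := by
    intro h hh N x y a hr
    obtain ⟨l, hl, hle⟩ := hscale x y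
    have h1 := (hr.smul (hqq h) l).sub_le (V := V) (hVflow h hh)
    exact le_of_mul_le_mul_left (hle.trans h1) (by positivity)
  obtain ⟨c', hc', C, hex⟩ := exists_sampled_storage (U := U) A hc hκ hA
  have hex' := fun n : ℕ => hex n (constFlow A B (1 / ((n : ℝ) + 1)) : X × U →ₗ[ℝ] X)
    (q (1 / ((n : ℝ) + 1))) (hqq _) (hq0 _ (by positivity)) (hfree _) (hstar _ (by positivity))
  choose P hPs hPn hPc hP using hex'
  have hproper : ProperSpace (X →L[ℝ] X →L[ℝ] ℝ) := FiniteDimensional.proper ℝ (X →L[ℝ] X →L[ℝ] ℝ)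
  obtain ⟨P₀, -, k, hk, hlim⟩ := tendsto_subseq_of_bounded
    (Metric.isBounded_closedBall (x := (0 : X →L[ℝ] X →L[ℝ] ℝ)) (r := |C|)) (x := P) (fun n => by
      refine (mem_closedBall_zero_iff (E := X →L[ℝ] X →L[ℝ] ℝ)).2 ?_
      refine ContinuousLinearMap.opNorm_le_bound₂ _ (abs_nonneg C) fun x y => ?_
      rw [Real.norm_eq_abs, mul_assoc]
      exact (hPn n x y).trans (by gcongr; exact le_abs_self C))
  have hev : ∀ {f g : ℕ → X} {x y : X}, Tendsto f atTop (𝓝 x) → Tendsto g atTop (𝓝 y) →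
      Tendsto (fun n => P (k n) (f n) (g n)) atTop (𝓝 (P₀ x y)) := fun hf hg =>
    ((isBoundedBilinearMap_apply (𝕜 := ℝ) (E := X) (F := ℝ)).continuous.tendsto _).comp
      ((((isBoundedBilinearMap_apply (𝕜 := ℝ) (E := X) (F := X →L[ℝ] ℝ)).continuous.tendsto _).comp
        (hlim.prodMk_nhds hf)).prodMk_nhds hg)
  refine ⟨P₀, fun x y => ?_, fun x hx => ?_, fun x u => ?_⟩
  · exact tendsto_nhds_unique (hev (tendsto_const_nhds (x := x)) (tendsto_const_nhds (x := y)))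
      ((hev tendsto_const_nhds tendsto_const_nhds).congr fun n => hPs (k n) y x)
  · have h1 : c' * ‖x‖ ^ 2 ≤ P₀ x x :=
      ge_of_tendsto (hev (tendsto_const_nhds (x := x)) (tendsto_const_nhds (x := x)))
        (Eventually.of_forall fun n => hPc (k n) x)
    have h2 : 0 < ‖x‖ := norm_pos_iff.2 hx
    exact lt_of_lt_of_le (by positivity) h1
  · set z : X × U := (x, u) with hz
    -- By symmetry, the increment of the form is `P (φ z - x) (φ z + x)`. After multiplication by `n
    -- + 1`, its arguments tend to `A x + B u` and `x + x`.
    have d1 : Tendsto (fun n : ℕ => ((n : ℝ) + 1) • (constFlow A B (1 / ((n : ℝ) + 1)) z - x))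
        atTop (𝓝 (A x + B u)) := by
      have := tendsto_slope_nat (hasDerivAt_constFlow A B z 0)
      simpa only [constFlow_zero] using this
    have d2 : Tendsto (fun n : ℕ => constFlow A B (1 / ((n : ℝ) + 1)) z + x) atTop
        (𝓝 (x + x)) := by
      have h1 := ((hflowc z).tendsto 0).comp (tendsto_one_div_add_atTop_nhds_zero_nat (𝕜 := ℝ))
      rw [constFlow_zero] at h1
      exact h1.add_const x
    have d3 : Tendsto (fun n : ℕ => ((n : ℝ) + 1) * q (1 / ((n : ℝ) + 1)) z) atTop
        (𝓝 (s (x, u))) := by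
      have h1 : HasDerivAt (fun h => q h z) (s (constFlow A B 0 z, z.2)) 0 :=
        intervalIntegral.integral_hasDerivAt_right (hint z 0)
          ((hsflow z).stronglyMeasurableAtFilter _ _) (hsflow z).continuousAt
      have h2 := tendsto_slope_nat h1
      rw [constFlow_zero] at h2
      refine h2.congr fun n => ?_
      simp [hq]
    have d4 := le_of_tendsto_of_tendsto'
      (hev (d1.comp hk.tendsto_atTop) (d2.comp hk.tendsto_atTop)) (d3.comp hk.tendsto_atTop)
      (fun n => by
        have h1 := hP (k n) z
        simp only [Function.comp_apply, map_smul, smul_apply, smul_eq_mul]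
        gcongr
        refine le_trans (le_of_eq ?_) h1
        simp only [map_sub, map_add, sub_apply]
        rw [hPs (k n) x]
        simp only [hz, ContinuousLinearMap.coe_coe]
        ring)
    have e1 : P₀ (A x + B u) (x + x) = 2 * P₀ x (A x + B u) := by
      have h1 := tendsto_nhds_unique
        (hev (tendsto_const_nhds (x := x)) (tendsto_const_nhds (x := A x + B u)))
        ((hev tendsto_const_nhds tendsto_const_nhds).congr fun n => hPs (k n) (A x + B u) x)
      rw [map_add, h1]; ring
    rw [← e1]
    exact d4

end ContinuousTime

/-! ### Quadratic storage along Carathéodory trajectories -/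

namespace CTLTISystem

open Matrix

variable {n p m : ℕ}

theorem memLp_state {sys : CTLTISystem n p m} {x : ℝ → Fin n → ℝ} {u : ℝ → Fin p → ℝ}
    (h : sys.IsTrajectory x u) (T : ℝ) : MemLp x 2 (volume.restrict (Set.Icc 0 T)) := by
  have hc : ContinuousOn x (Set.Icc 0 T) := h.state_continuousOn.mono fun t ht => ht.1
  obtain ⟨M, hM⟩ := isCompact_Icc.exists_bound_of_continuousOn hc
  refine MemLp.of_bound (hc.aestronglyMeasurable measurableSet_Icc) M ?_
  exact (ae_restrict_iff' measurableSet_Icc).2 (Filter.Eventually.of_forall hM)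

theorem memLp_mulVec {k l : ℕ} (M : Matrix (Fin k) (Fin l) ℝ) {f : ℝ → Fin l → ℝ} {μ : Measure ℝ}
    (hf : MemLp f 2 μ) : MemLp (fun t => M *ᵥ f t) 2 μ :=
  (LinearMap.toContinuousLinearMap M.mulVecLin).comp_memLp' hf

/-- The right-hand side of the state equation. -/
def rhs (sys : CTLTISystem n p m) (x : ℝ → Fin n → ℝ) (u : ℝ → Fin p → ℝ) (t : ℝ) : Fin n → ℝ :=
  sys.A *ᵥ x t + sys.B *ᵥ u t

theorem intervalIntegrable_rhs {sys : CTLTISystem n p m} {x : ℝ → Fin n → ℝ} {u : ℝ → Fin p → ℝ}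
    (h : sys.IsTrajectory x u) {T : ℝ} (hT : 0 ≤ T) :
    IntervalIntegrable (sys.rhs x u) volume 0 T := by
  rw [intervalIntegrable_iff_integrableOn_Icc_of_le hT]
  exact ((memLp_mulVec sys.A (memLp_state h T)).add
    (memLp_mulVec sys.B (h.input_memLp T))).integrable one_le_two

theorem state_eq_apply {sys : CTLTISystem n p m} {x : ℝ → Fin n → ℝ} {u : ℝ → Fin p → ℝ}
    (h : sys.IsTrajectory x u) {t : ℝ} (ht : 0 ≤ t) (i : Fin n) :
    x t i = x 0 i + ∫ s in (0 : ℝ)..t, sys.rhs x u s i := by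
  have h1 := congrFun (h.state_eq t ht) i
  rw [Pi.add_apply] at h1
  rw [h1]
  congr 1
  exact ((ContinuousLinearMap.proj (R := ℝ) (φ := fun _ : Fin n => ℝ) i).intervalIntegral_comp_comm
    (intervalIntegrable_rhs h ht)).symm

theorem integrableOn_supplyRate {sys : CTLTISystem n p m} {x : ℝ → Fin n → ℝ} {u : ℝ → Fin p → ℝ}
    (h : sys.IsTrajectory x u) (Q : Matrix (Fin m) (Fin m) ℝ) (S : Matrix (Fin m) (Fin p) ℝ)
    (R : Matrix (Fin p) (Fin p) ℝ) (T : ℝ) :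
    IntegrableOn (fun t => supplyRate Q S R (sys.output x u t) (u t)) (Set.Icc 0 T) := by
  have hy : MemLp (sys.output x u) 2 (volume.restrict (Set.Icc 0 T)) :=
    (memLp_mulVec sys.C (memLp_state h T)).add (memLp_mulVec sys.D (h.input_memLp T))
  have hv : ∀ i : Fin m ⊕ Fin p, MemLp (fun t => Sum.elim (sys.output x u t) (u t) i) 2
      (volume.restrict (Set.Icc 0 T)) := by
    rintro (i | i)
    · exact hy.eval i
    · exact (h.input_memLp T).eval i
  unfold IntegrableOn supplyRate
  simp only [dotProduct, mulVec]
  refine integrable_finsetSum _ fun i _ => ?_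
  refine (hv i).integrable_mul (q := 2) ?_
  exact memLp_finsetSum _ fun j _ => (hv j).const_mul _

/-- A quadratic function that satisfies the dissipation inequality pointwise satisfies it along
trajectories. -/
theorem quadratic_sub_le {sys : CTLTISystem n p m} {x : ℝ → Fin n → ℝ} {u : ℝ → Fin p → ℝ}
    (h : sys.IsTrajectory x u) {Q : Matrix (Fin m) (Fin m) ℝ} {S : Matrix (Fin m) (Fin p) ℝ}
    {R : Matrix (Fin p) (Fin p) ℝ} {P : Matrix (Fin n) (Fin n) ℝ} (hP : P.IsSymm)
    (hdiss : ∀ x u, 2 * (x ⬝ᵥ P *ᵥ (sys.A *ᵥ x + sys.B *ᵥ u)) ≤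
      supplyRate Q S R (sys.C *ᵥ x + sys.D *ᵥ u) u) {t₀ t₁ : ℝ} (h0 : 0 ≤ t₀) (h1 : t₀ ≤ t₁) :
    x t₁ ⬝ᵥ P *ᵥ x t₁ - x t₀ ⬝ᵥ P *ᵥ x t₀ ≤
      ∫ t in t₀..t₁, supplyRate Q S R (sys.output x u t) (u t) := by
  have ht₁ : 0 ≤ t₁ := h0.trans h1
  set f := sys.rhs x u with hf
  have hfi : ∀ i, IntervalIntegrable (fun t => f t i) volume 0 t₁ := fun i =>
    ⟨(ContinuousLinearMap.proj (R := ℝ) (φ := fun _ : Fin n => ℝ) i).integrable_comp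
      (intervalIntegrable_rhs h ht₁).1,
    (ContinuousLinearMap.proj (R := ℝ) (φ := fun _ : Fin n => ℝ) i).integrable_comp
      (intervalIntegrable_rhs h ht₁).2⟩
  -- The state is unconstrained at negative times. The primitive `y i` agrees with it for `t ≥ 0`,
  -- is absolutely continuous on the interval and has derivative `f` almost everywhere there, as the
  -- product rule needs.
  let y : Fin n → ℝ → ℝ := fun i t => x 0 i + ∫ s in (0 : ℝ)..t, f s i
  have hyx : ∀ i t, 0 ≤ t → y i t = x t i := fun i t ht => (state_eq_apply h ht i).symm
  have hac : ∀ i, AbsolutelyContinuousOnInterval (y i) t₀ t₁ := by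
    intro i
    have h2 : AbsolutelyContinuousOnInterval (fun t => ∫ s in (0 : ℝ)..t, f s i) 0 t₁ :=
      (hfi i).absolutelyContinuousOnInterval_intervalIntegral (c := 0) (by simp)
    have h3 : AbsolutelyContinuousOnInterval (fun _ : ℝ => x 0 i) 0 t₁ :=
      (LipschitzWith.const (x 0 i)).lipschitzOnWith.absolutelyContinuousOnInterval
    refine (h3.add h2).mono ?_
    rw [Set.uIcc_of_le h1, Set.uIcc_of_le ht₁]
    exact Set.Icc_subset_Icc_left h0
  have hderiv : ∀ᵐ t, t ∈ Set.Icc t₀ t₁ → ∀ i, deriv (y i) t = f t i := by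
    have h2 : ∀ i, ∀ᵐ t, t ∈ Set.Icc t₀ t₁ → deriv (y i) t = f t i := by
      intro i
      filter_upwards [(hfi i).ae_hasDerivAt_integral] with t ht hmem
      rw [Set.uIcc_of_le ht₁] at ht
      exact ((ht ⟨h0.trans hmem.1, hmem.2⟩ 0 ⟨le_rfl, ht₁⟩).const_add (x 0 i)).deriv
    filter_upwards [ae_all_iff.2 h2] with t ht hmem i
    exact ht i hmem
  have hprod : ∀ i j, IntervalIntegrable
      (fun t => P i j * (deriv (y i) t * y j t + y i t * deriv (y j) t)) volume t₀ t₁ := fun i j =>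
    (((hac i).intervalIntegrable_deriv.mul_continuousOn (hac j).continuousOn).add
      ((hac j).intervalIntegrable_deriv.continuousOn_mul (hac i).continuousOn)).const_mul _
  have hsum : ∀ i, IntervalIntegrable
      (fun t => ∑ j, P i j * (deriv (y i) t * y j t + y i t * deriv (y j) t)) volume t₀ t₁ := by
    intro i
    have h2 := IntervalIntegrable.sum Finset.univ fun j _ => hprod i j
    rwa [Finset.sum_fn] at h2
  have e1 : x t₁ ⬝ᵥ P *ᵥ x t₁ - x t₀ ⬝ᵥ P *ᵥ x t₀ =
      ∫ t in t₀..t₁, ∑ i, ∑ j, P i j * (deriv (y i) t * y j t + y i t * deriv (y j) t) := by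
    rw [intervalIntegral.integral_finsetSum fun i _ => hsum i]
    simp only [dotProduct, mulVec, Finset.mul_sum, ← Finset.sum_sub_distrib]
    refine Finset.sum_congr rfl fun i _ => ?_
    rw [intervalIntegral.integral_finsetSum fun j _ => hprod i j]
    refine Finset.sum_congr rfl fun j _ => ?_
    rw [intervalIntegral.integral_const_mul, (hac i).integral_deriv_mul_eq_sub (hac j)]
    rw [hyx i _ ht₁, hyx j _ ht₁, hyx i _ h0, hyx j _ h0]
    ring
  rw [e1]
  refine intervalIntegral.integral_mono_ae_restrict h1 ?_ ?_ ?_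
  · have h2 := IntervalIntegrable.sum Finset.univ fun i _ => hsum i
    rwa [Finset.sum_fn] at h2
  · rw [intervalIntegrable_iff_integrableOn_Icc_of_le h1]
    exact (integrableOn_supplyRate h Q S R t₁).mono_set (Set.Icc_subset_Icc_left h0)
  · rw [Filter.EventuallyLE, ae_restrict_iff' measurableSet_Icc]
    filter_upwards [hderiv] with t ht hmem
    have h2 := hdiss (x t) (u t)
    refine le_trans (le_of_eq ?_) h2
    have h3 : ∀ v w : Fin n → ℝ, ∑ i, ∑ j, P i j * (v i * w j + w i * v j) = 2 * (w ⬝ᵥ P *ᵥ v) := by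
      intro v w
      have h4 : ∑ i, ∑ j, P i j * (v i * w j) = ∑ i, ∑ j, P i j * (w i * v j) := by
        rw [Finset.sum_comm]
        refine Finset.sum_congr rfl fun i _ => Finset.sum_congr rfl fun j _ => ?_
        rw [hP.apply]
        ring
      simp only [mul_add, Finset.sum_add_distrib, h4]
      rw [← two_mul]
      congr 1
      simp only [dotProduct, mulVec, Finset.mul_sum]
      exact Finset.sum_congr rfl fun i _ => Finset.sum_congr rfl fun j _ => by ring
    rw [← h3]
    refine Finset.sum_congr rfl fun i _ => Finset.sum_congr rfl fun j _ => ?_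
    rw [ht hmem i, ht hmem j, hyx i t (h0.trans hmem.1), hyx j t (h0.trans hmem.1)]
    rfl

end CTLTISystem

open Matrix in
theorem real_dotProduct_transpose_mulVec {ι κ : Type*} [Fintype ι] [Fintype κ] (M : Matrix ι κ ℝ)
    (a : κ → ℝ) (b : ι → ℝ) : a ⬝ᵥ Mᵀ *ᵥ b = b ⬝ᵥ M *ᵥ a := by
  rw [mulVec_transpose, dotProduct_comm, ← dotProduct_mulVec]

open Matrix in
theorem real_dotProduct_transpose_mul_mulVec {ι κ l : Type*} [Fintype ι] [Fintype κ] [Fintype l]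
    (M : Matrix ι κ ℝ) (N : Matrix ι l ℝ) (a : κ → ℝ) (b : l → ℝ) :
    a ⬝ᵥ (Mᵀ * N) *ᵥ b = (M *ᵥ a) ⬝ᵥ (N *ᵥ b) := by
  rw [← mulVec_mulVec, real_dotProduct_transpose_mulVec, dotProduct_comm]

/-! ### Schur complement of the LMI -/

section LMI

open Matrix CTLTISystem

variable {n m q l : ℕ}

theorem supplyRate_eq (Q : Matrix (Fin l) (Fin l) ℝ) (S : Matrix (Fin l) (Fin q) ℝ)
    (R : Matrix (Fin q) (Fin q) ℝ) (z : Fin l → ℝ) (u : Fin q → ℝ) :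
    supplyRate Q S R z u = z ⬝ᵥ Q *ᵥ z + 2 * (z ⬝ᵥ S *ᵥ u) + u ⬝ᵥ R *ᵥ u := by
  rw [supplyRate, fromBlocks_mulVec, sumElim_dotProduct_sumElim]
  simp only [Sum.elim_comp_inl, Sum.elim_comp_inr, dotProduct_add, real_dotProduct_transpose_mulVec]
  ring

/-- The linear matrix inequality is the pointwise dissipation inequality for `xᵀ P x`. -/
theorem posSemidef_dissipativeObserverLMI_iff
    (A : Matrix (Fin n) (Fin n) ℝ) (C : Matrix (Fin m) (Fin n) ℝ)
    (E : Matrix (Fin n) (Fin q) ℝ) (F : Matrix (Fin m) (Fin q) ℝ)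
    (G : Matrix (Fin l) (Fin n) ℝ) (J : Matrix (Fin l) (Fin q) ℝ)
    (L : Matrix (Fin n) (Fin m) ℝ)
    {Q : Matrix (Fin l) (Fin l) ℝ} (S : Matrix (Fin l) (Fin q) ℝ)
    {R : Matrix (Fin q) (Fin q) ℝ} (hQ : (-Q).PosDef) (hR : R.IsSymm)
    (P : Matrix (Fin n) (Fin n) ℝ) :
    (dissipativeObserverLMI A C E F G J Q S R P (P * L)).PosSemidef ↔
      ∀ x u, 2 * (x ⬝ᵥ P *ᵥ ((A - L * C) *ᵥ x + (E - L * F) *ᵥ u)) ≤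
        supplyRate Q S R (G *ᵥ x + J *ᵥ u) u := by
  have hQu : IsUnit Q.det := by
    have := hQ.isUnit
    rw [IsUnit.neg_iff] at this
    exact (isUnit_iff_isUnit_det Q).1 this
  have hD : (-Q⁻¹).PosDef := by
    have h1 := hQ.inv
    have h2 : (-Q)⁻¹ = -Q⁻¹ := inv_eq_right_inv (by rw [neg_mul_neg, mul_nonsing_inv _ hQu])
    rwa [h2] at h1
  have hDinv : (-Q⁻¹)⁻¹ = -Q :=
    inv_eq_right_inv (by rw [neg_mul_neg, nonsing_inv_mul _ hQu])
  let _ : Invertible (-Q⁻¹) := hD.isUnit.invertible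
  have hcols : fromCols G J = (fromRows Gᵀ Jᵀ)ᴴ := by
    rw [conjTranspose_eq_transpose_of_trivial, transpose_fromRows, transpose_transpose,
      transpose_transpose]
  -- The Schur complement subtracts `zᵀ (-Q) z` with `z = G x + J u`, which supplies the term `zᵀ Q
  -- z` of the supply rate.
  have hquad : ∀ (x : Fin n → ℝ) (u : Fin q → ℝ), Sum.elim x u ⬝ᵥ
      (fromBlocks (-symPart (P * A - P * L * C)) (-(P * E) + P * L * F + Gᵀ * S)
        (-(P * E) + P * L * F + Gᵀ * S)ᵀ (symPart (Jᵀ * S) + R) -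
          fromRows Gᵀ Jᵀ * (-Q⁻¹)⁻¹ * (fromRows Gᵀ Jᵀ)ᴴ) *ᵥ Sum.elim x u =
      supplyRate Q S R (G *ᵥ x + J *ᵥ u) u -
        2 * (x ⬝ᵥ P *ᵥ ((A - L * C) *ᵥ x + (E - L * F) *ᵥ u)) := by
    intro x u
    have e1 : Sum.elim x u ⬝ᵥ (fromRows Gᵀ Jᵀ * (-Q⁻¹)⁻¹ * (fromRows Gᵀ Jᵀ)ᴴ) *ᵥ Sum.elim x u =
        -((G *ᵥ x + J *ᵥ u) ⬝ᵥ Q *ᵥ (G *ᵥ x + J *ᵥ u)) := by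
      have e2 : fromRows Gᵀ Jᵀ = (fromCols G J)ᵀ := by rw [transpose_fromCols]
      rw [hDinv, ← hcols, e2, Matrix.mul_assoc, real_dotProduct_transpose_mul_mulVec, ← mulVec_mulVec,
        fromCols_mulVec, neg_mulVec, dotProduct_neg]
      simp
    rw [sub_mulVec, dotProduct_sub, e1, supplyRate_eq, fromBlocks_mulVec,
      sumElim_dotProduct_sumElim]
    simp only [Sum.elim_comp_inl, Sum.elim_comp_inr, dotProduct_add, real_dotProduct_transpose_mulVec,
      symPart, add_mulVec, neg_mulVec, dotProduct_neg, sub_mulVec, dotProduct_sub, mulVec_add,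
      mulVec_sub, real_dotProduct_transpose_mul_mulVec, add_dotProduct, mulVec_mulVec, Matrix.mul_assoc]
    ring
  rw [dissipativeObserverLMI, hcols, PosDef.fromBlocks₂₂ _ _ hD]
  constructor
  · intro h x u
    have h1 := h.dotProduct_mulVec_nonneg (Sum.elim x u)
    rw [star_trivial, hquad] at h1
    linarith
  · intro h
    refine .of_dotProduct_mulVec_nonneg ?_ fun v => ?_
    · refine IsHermitian.sub ?_ ?_
      · refine IsHermitian.fromBlocks ?_ ?_ ?_
        · rw [IsHermitian, conjTranspose_eq_transpose_of_trivial]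
          simp [symPart, add_comm]
        · rw [conjTranspose_eq_transpose_of_trivial]
        · rw [IsHermitian, conjTranspose_eq_transpose_of_trivial]
          simp [symPart, add_comm, hR.eq]
      · exact isHermitian_mul_mul_conjTranspose _ hD.1.inv
    · rw [star_trivial, ← Sum.elim_comp_inl_inr v, hquad]
      linarith [h (v ∘ Sum.inl) (v ∘ Sum.inr)]

end LMI

/-! ### Dissipativity and positive definite matrices -/

namespace CTLTISystem

open Matrix

variable {n p m : ℕ}

theorem isTrajectory_of_hasDerivAt (sys : CTLTISystem n p m) {x : ℝ → Fin n → ℝ} {u : Fin p → ℝ}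
    (h : ∀ t, HasDerivAt x (sys.A *ᵥ x t + sys.B *ᵥ u) t) : sys.IsTrajectory x fun _ => u := by
  have hc : Continuous x := continuous_iff_continuousAt.2 fun t => (h t).continuousAt
  refine ⟨fun T => memLp_const u, hc.continuousOn, fun t _ => ?_⟩
  have hc' : Continuous fun t => sys.A *ᵥ x t + sys.B *ᵥ u := by fun_prop
  rw [intervalIntegral.integral_eq_sub_of_hasDerivAt (fun s _ => h s) (hc'.intervalIntegrable 0 t)]
  abel

/-- Dissipativity is equivalent to the existence of a positive definite quadratic storage function,
provided that the output enters the supply rate negatively. -/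
theorem isDissipative_iff_exists_posDef (sys : CTLTISystem n p m) {Q : Matrix (Fin m) (Fin m) ℝ}
    (S : Matrix (Fin m) (Fin p) ℝ) (R : Matrix (Fin p) (Fin p) ℝ) (hQ : (-Q).PosDef) :
    sys.IsDissipative Q S R ↔ ∃ P : Matrix (Fin n) (Fin n) ℝ, P.PosDef ∧
      ∀ x u, 2 * (x ⬝ᵥ P *ᵥ (sys.A *ᵥ x + sys.B *ᵥ u)) ≤
        supplyRate Q S R (sys.C *ᵥ x + sys.D *ᵥ u) u := by
  constructor
  · rintro ⟨V, hV, hdiss⟩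
    -- `Fin n → ℝ` carries the sup norm, whereas the construction needs `‖x‖ ^ 2` to be quadratic.
    let e : EuclideanSpace ℝ (Fin n) ≃L[ℝ] (Fin n → ℝ) := EuclideanSpace.equiv (Fin n) ℝ
    let A' : EuclideanSpace ℝ (Fin n) →L[ℝ] EuclideanSpace ℝ (Fin n) :=
      e.symm.toContinuousLinearMap ∘L (LinearMap.toContinuousLinearMap sys.A.mulVecLin) ∘L
        e.toContinuousLinearMap
    let B' : (Fin p → ℝ) →L[ℝ] EuclideanSpace ℝ (Fin n) :=
      e.symm.toContinuousLinearMap ∘L (LinearMap.toContinuousLinearMap sys.B.mulVecLin)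
    let f : EuclideanSpace ℝ (Fin n) × (Fin p → ℝ) →ₗ[ℝ] (Fin m ⊕ Fin p → ℝ) :=
      { toFun := fun z => Sum.elim (sys.C *ᵥ e z.1 + sys.D *ᵥ z.2) z.2
        map_add' := fun z w => by
          ext (i | i) <;> simp [mulVec_add]
          ring
        map_smul' := fun t z => by
          ext (i | i) <;> simp [mulVec_smul]
          ring }
    have hqf : IsQuad fun v : Fin m ⊕ Fin p → ℝ => v ⬝ᵥ (fromBlocks Q S Sᵀ R) *ᵥ v :=
      ⟨fun t v => by
        simp only [mulVec_smul, dotProduct_smul, smul_dotProduct, smul_eq_mul]; ring,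
        fun v w => by
          simp only [mulVec_add, mulVec_sub, dotProduct_add, dotProduct_sub, add_dotProduct,
            sub_dotProduct]
          ring⟩
    have hfc : Continuous f := LinearMap.continuous_of_finiteDimensional f
    obtain ⟨P, hPs, hPpos, hP⟩ := exists_quadratic_storage A' B'
      (s := fun z => supplyRate Q S R (sys.C *ᵥ e z.1 + sys.D *ᵥ z.2) z.2)
      (hqf.comp f)
      (by
        have h1 : Continuous fun v : Fin m ⊕ Fin p → ℝ => v ⬝ᵥ (fromBlocks Q S Sᵀ R) *ᵥ v := by
          fun_prop
        exact h1.comp hfc)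
      -- Zero input leaves only `zᵀ Q z` in the supply rate; here the sign of `Q` enters the
      -- construction.
      (fun x => by
        rw [supplyRate_eq]
        have h1 := hQ.posSemidef.dotProduct_mulVec_nonneg (sys.C *ᵥ e x)
        rw [star_trivial, neg_mulVec, dotProduct_neg] at h1
        simpa using h1)
      (V := fun x => V (e x)) (hV.continuous.comp e.continuous) (by simpa using hV.map_zero)
      (fun x hx => hV.pos _ (by simpa using hx))
      (fun x u hx h hh => by
        have h1 : ∀ t, HasDerivAt (fun t => e (x t)) (sys.A *ᵥ e (x t) + sys.B *ᵥ u) t := by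
          intro t
          have h2 := e.toContinuousLinearMap.hasFDerivAt.comp_hasDerivAt t (hx t)
          refine h2.congr_deriv ?_
          simp [A', B']
        exact hdiss _ _ (sys.isTrajectory_of_hasDerivAt h1) 0 h le_rfl hh)
    let b : (Fin n → ℝ) →ₗ[ℝ] (Fin n → ℝ) →ₗ[ℝ] ℝ :=
      LinearMap.mk₂ ℝ (fun x y => P (e.symm x) (e.symm y)) (by simp) (by simp) (by simp) (by simp)
    set M := LinearMap.toMatrix₂' ℝ b with hM
    have hMb : ∀ x y, x ⬝ᵥ M *ᵥ y = P (e.symm x) (e.symm y) := by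
      intro x y
      rw [← Matrix.toLinearMap₂'_apply', hM, Matrix.toLinearMap₂'_toMatrix']
      rfl
    refine ⟨M, .of_dotProduct_mulVec_pos ?_ fun x hx => ?_, fun x u => ?_⟩
    · ext i j
      rw [conjTranspose_apply, star_trivial, hM, LinearMap.toMatrix₂'_apply,
        LinearMap.toMatrix₂'_apply]
      exact hPs _ _
    · rw [star_trivial, hMb]
      exact hPpos _ (by simpa using hx)
    · have h1 := hP (e.symm x) u
      rw [hMb, map_add]
      simpa [A', B'] using h1
  · rintro ⟨P, hP, hdiss⟩
    have hPs : P.IsSymm := by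
      have := hP.1
      rwa [IsHermitian, conjTranspose_eq_transpose_of_trivial] at this
    refine ⟨fun x => x ⬝ᵥ P *ᵥ x, ⟨by fun_prop, by simp, fun x hx => ?_⟩, ?_⟩
    · simpa using hP.dotProduct_mulVec_pos hx
    · exact fun x u h t₀ t₁ h0 h1 => quadratic_sub_le h hPs hdiss h0 h1

end CTLTISystem

theorem mainTheorem4 {n m q l : ℕ}
    (A : Matrix (Fin n) (Fin n) ℝ) (C : Matrix (Fin m) (Fin n) ℝ)
    (E : Matrix (Fin n) (Fin q) ℝ) (F : Matrix (Fin m) (Fin q) ℝ)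
    (G : Matrix (Fin l) (Fin n) ℝ) (J : Matrix (Fin l) (Fin q) ℝ)
    (L : Matrix (Fin n) (Fin m) ℝ)
    (Q : Matrix (Fin l) (Fin l) ℝ) (S : Matrix (Fin l) (Fin q) ℝ)
    (R : Matrix (Fin q) (Fin q) ℝ)
    (hQ : (-Q).PosDef) (hR : R.IsSymm) :
    (luenbergerErrorSystem A C E F G J L).IsDissipative Q S R ↔
      ∃ (P : Matrix (Fin n) (Fin n) ℝ) (K : Matrix (Fin n) (Fin m) ℝ),
        P.PosDef ∧
        (dissipativeObserverLMI A C E F G J Q S R P K).PosSemidef ∧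
        L = P⁻¹ * K := by
  rw [CTLTISystem.isDissipative_iff_exists_posDef _ S R hQ]
  constructor
  · rintro ⟨P, hP, h⟩
    refine ⟨P, P * L, hP,
      (posSemidef_dissipativeObserverLMI_iff A C E F G J L S hQ hR P).2 h, ?_⟩
    rw [Matrix.nonsing_inv_mul_cancel_left _ _ ((Matrix.isUnit_iff_isUnit_det P).1 hP.isUnit)]
  · rintro ⟨P, K, hP, h, rfl⟩
    refine ⟨P, hP, (posSemidef_dissipativeObserverLMI_iff A C E F G J (P⁻¹ * K) S hQ hR P).1 ?_⟩
    rwa [Matrix.mul_nonsing_inv_cancel_left _ _ ((Matrix.isUnit_iff_isUnit_det P).1 hP.isUnit)]
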